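/- Let $\mathbb{H}=\{(r,\theta): r>0,\ \theta\in\mathbb{R}\}$ and, for $a>0$, $\mathbb{H}_a=\{(r,\theta)\in\mathbb{H}: |\theta|<a\}$. A function $f$ on an open set $D\subset\mathbb{H}$ is polar-analytic on $D$ if for every $(r_0,\theta_0)\in D$ the limit of $\frac{f(r,\theta)-f(r_0,\theta_0)}{re^{i\theta}-r_0e^{i\theta_0}}$ as $(r,\theta)\to(r_0,\theta_0)$ within $D$ exists. For $c\in\mathbb{R}$ and $1\le p<\infty$ let $X^p_c$ be the space of measurable $\varphi:(0,\infty)\to\mathbb{C}$ with $\|\varphi\|_{X^p_c}=\big(\int_0^\infty|\varphi(r)|^pr^{cp-1}\,dr\big)^{1/p}<\infty$. The Mellin–Hardy space $H^p_c(\mathbb{H}_a)$ consists of all polar-analytic $f:\mathbb{H}_a\to\mathbb{C}$ such that $f(\cdot,\theta)\in X^p_c$ for every $|\theta|<a$ and $$\|f\|_{H^p_c(\mathbb{H}_a)}:=\sup_{0<\theta<a}\Big(\tfrac12\big(\|f(\cdot,\theta)\|^p_{X^p_c}+\|f(\cdot,-\theta)\|^p_{X^p_c}\big)\Big)^{1/p}<\infty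 .$$ For $\sigma>0$ the Mellin–Bernstein space $\mathscr{B}^p_{c,\sigma}$ consists of all polar-analytic $g:\mathbb{H}\to\mathbb{C}$ such that $g(\cdot,0)\in X^p_c$ and, for some constant $C>0$, $|g(r,\theta)|\le Cr^{-c}e^{\sigma|\theta|}$ on $\mathbb{H}$. For $q\in[1,\infty]$ let $G^q_c$ be the space of all $\varphi:(0,\infty)\to\mathbb{C}$ of the form $\varphi(x)=\frac1{2\pi}\int_{-\infty}^\infty\psi(v)x^{-c-iv}\,dv$ ($x>0$) with $\psi\in L^1(\mathbb{R})\cap L^q(\mathbb{R})$, normed by $[\![\varphi]\!]_q:=\|\psi\|_{L^q(\mathbb{R})}$ ($\psi$ is unique up to null sets), and put $\mathrm{dist}_q(f,\mathscr{B}^p_{c,\sigma}):=\inf_{g\in\mathscr{B}^p_{c,\sigma}}[\![f(\cdot,0)-g(\cdot,0)]\!]_q$, with the convention $[\![\varphi]\!]_q=\infty$ if $\varphi\notin G^q_c$. **Theorem 6.** Let $a,\sigma>0$ and $c\in\mathbb{R}$. (a) If $f\in H^1_c(\mathbb{H}_a)$, then for every $q\in[1,\infty]$ we have $f(\cdot,0)\in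 G^q_c$ and $$\mathrm{dist}_q(f,\mathscr{B}^1_{c,\sigma})\le 2\|f\|_{H^1_c(\mathbb{H}_a)}\Big(\frac{2}{aq}\Big)^{1/q}e^{-a\sigma},$$ where $(2/(aq))^{1/q}$ is read as $1$ for $q=\infty$. (b) If $f\in H^2_c(\mathbb{H}_a)$, then $f(\cdot,0)\in G^2_c$ and $$\mathrm{dist}_2(f,\mathscr{B}^2_{c,\sigma})\le 2\sqrt{\pi}\,\|f\|_{H^2_c(\mathbb{H}_a)}\,e^{-a\sigma}.$$ (c) If $f\in H^2_c(\mathbb{H}_a)$, then for every $q\in[1,2)$ we have $f(\cdot,0)\in G^q_c$ and $$\mathrm{dist}_q(f,\mathscr{B}^2_{c,\sigma})\le 2\sqrt{\pi}\Big(\frac{2-q}{qa}\Big)^{\frac1q-\frac12}\|f\|_{H^2_c(\mathbb{H}_a)}\,e^{-a\sigma}.$$ -/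

import Mathlib

open Set Filter Topology MeasureTheory
open scoped ENNReal

noncomputable section

/-- The half-plane of all pairs `(r, θ)` with `r > 0` and `θ` real (polar coordinates treated as
Cartesian coordinates; `θ` is not taken modulo `2π`). -/
def polarPlane : Set (ℝ × ℝ) := {x | 0 < x.1}

/-- The strip of all `(r, θ)` with `r > 0` and `-a < θ < a`. -/
def polarStrip (a : ℝ) : Set (ℝ × ℝ) := {x | 0 < x.1 ∧ -a < x.2 ∧ x.2 < a}

/-- The complex number `r e^{iθ}` belonging to the pair `(r, θ)`. -/
def polarPoint (x : ℝ × ℝ) : ℂ := (x.1 : ℂ) * Complex.exp ((x.2 : ℂ) * Complex.I)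

/-- `f` is polar-analytic on `D`: at every point of `D` the difference quotient of `f` with
respect to `r e^{iθ}` has a limit, the point being approached within `D`. -/
def PolarAnalyticOn (f : ℝ × ℝ → ℂ) (D : Set (ℝ × ℝ)) : Prop :=
  ∀ x₀ ∈ D, ∃ d : ℂ,
    Tendsto (fun x => (f x - f x₀) / (polarPoint x - polarPoint x₀)) (𝓝[D \ {x₀}] x₀) (𝓝 d)

/-- The weighted function `r ↦ r^{c - 1/p} φ(r)`. -/
def mellinWeight (p c : ℝ) (φ : ℝ → ℂ) : ℝ → ℂ :=
  fun r => ((r ^ (c - 1 / p) : ℝ) : ℂ) * φ r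

/-- `φ ∈ X^p_c`: the function `r ↦ r^{c - 1/p} φ(r)` belongs to `L^p(0, ∞)`. -/
def MemMellinX (p c : ℝ) (φ : ℝ → ℂ) : Prop :=
  MemLp (mellinWeight p c φ) (ENNReal.ofReal p) (volume.restrict (Ioi 0))

/-- The norm of `X^p_c`, `(∫₀^∞ |φ(r)|^p r^{cp-1} dr)^{1/p}`, with value `∞` allowed. -/
def mellinXNorm (p c : ℝ) (φ : ℝ → ℂ) : ℝ≥0∞ :=
  eLpNorm (mellinWeight p c φ) (ENNReal.ofReal p) (volume.restrict (Ioi 0))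

/-- The Mellin-Hardy norm on the strip `|θ| < a`, with value `∞` allowed. -/
def mellinHardyENorm (p c a : ℝ) (f : ℝ × ℝ → ℂ) : ℝ≥0∞ :=
  ⨆ θ ∈ Ioo 0 a,
    ((mellinXNorm p c (fun r => f (r, θ)) ^ p + mellinXNorm p c (fun r => f (r, -θ)) ^ p) / 2)
      ^ (1 / p)

/-- The Mellin-Hardy norm as a real number. -/
def mellinHardyNorm (p c a : ℝ) (f : ℝ × ℝ → ℂ) : ℝ := (mellinHardyENorm p c a f).toReal

/-- The Mellin-Hardy space `H^p_c` of the strip `|θ| < a`. Only the values of `f` on the strip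
matter. -/
structure MemMellinHardy (p c a : ℝ) (f : ℝ × ℝ → ℂ) : Prop where
  polarAnalytic : PolarAnalyticOn f (polarStrip a)
  memX : ∀ θ ∈ Ioo (-a) a, MemMellinX p c (fun r => f (r, θ))
  norm_lt_top : mellinHardyENorm p c a f < ⊤

/-- The Mellin-Bernstein space `𝓑^p_{c,T}`. -/
structure MemMellinBernstein (p c T : ℝ) (f : ℝ × ℝ → ℂ) : Prop where
  polarAnalytic : PolarAnalyticOn f polarPlane
  memX : MemMellinX p c (fun r => f (r, 0))
  bound : ∃ C : ℝ, 0 < C ∧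
    ∀ r θ : ℝ, 0 < r → ‖f (r, θ)‖ ≤ C * r ^ (-c) * Real.exp (T * |θ|)

/-- `ψ ∈ L¹(ℝ) ∩ L^q(ℝ)` represents `φ` on `(0, ∞)`:
`φ(x) = (1/2π) ∫ ψ(v) x^{-c-iv} dv` for all `x > 0`. -/
structure IsMellinRep (q : ℝ≥0∞) (c : ℝ) (φ ψ : ℝ → ℂ) : Prop where
  integrable : Integrable ψ volume
  memLp : MemLp ψ q volume
  repr : ∀ x : ℝ, 0 < x →
    φ x = 1 / (2 * (Real.pi : ℂ)) * ∫ v : ℝ, ψ v * (x : ℂ) ^ (-(c : ℂ) - (v : ℂ) * Complex.I)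

/-- The space `G^q_c` of all functions with such a representation. -/
def MemMellinG (q : ℝ≥0∞) (c : ℝ) (φ : ℝ → ℂ) : Prop := ∃ ψ : ℝ → ℂ, IsMellinRep q c φ ψ

/-- The norm of `G^q_c`: the `L^q` norm of the representing function `ψ`. As `ψ` is unique up to
null sets, the infimum runs over a single value; it is `∞` exactly if `φ` is not in `G^q_c`. -/
def mellinGNorm (q : ℝ≥0∞) (c : ℝ) (φ : ℝ → ℂ) : ℝ≥0∞ :=
  ⨅ (ψ : ℝ → ℂ) (_ : IsMellinRep q c φ ψ), eLpNorm ψ q volume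

/-- The Mellin distance of `f` from the Mellin-Bernstein space `𝓑^p_{c,σ}`, taken between the
restrictions to the half-line `θ = 0`. -/
def mellinDist (q : ℝ≥0∞) (p c σ : ℝ) (f : ℝ × ℝ → ℂ) : ℝ≥0∞ :=
  ⨅ (g : ℝ × ℝ → ℂ) (_ : MemMellinBernstein p c σ g),
    mellinGNorm q c (fun x => f (x, 0) - g (x, 0))

end

open scoped FourierTransform ContDiff SchwartzMap Convolution

/-! In logarithmic coordinates, `F z = e^{cz} f(e^{Re z}, Im z)`, polar analyticity becomes
holomorphy on the strip |Im z| < a, and the X^p_c norm at angle θ becomes the L^p norm of `F` on the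
line Im z = θ. If `m` is the Fourier transform of `F` on the real line, the function representing
f(·, 0) is ψ(v) = m(-v/2π).

Moving the line of integration to height y multiplies the transform by e^{-2πyw}. Control up to
heights ±a therefore forces exponential decay. With N the Hardy norm, |ψ(v)| ≤ 2N e^{-a|v|} for p =
1 (`norm_fourier_le_of_strip`), and by Plancherel ψ(v) e^{a|v|} has L² norm at most 2√π N for p = 2
(`exists_fourierInv_eq_of_strip`).

Conversely, frequencies confined to [-σ, σ] synthesise Bernstein functions
(`memMellinBernstein_mellinExtension`). Cutting ψ off at σ thus gives a competitor g, and the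
distance is at most the L^q norm of the discarded tail (`mellinDist_le_eLpNorm`). That tail is
integrated directly for p = 1 and estimated by a supremum or by Hölder for p = 2. The requirement
g(·, 0) ∈ X^p_c dictates the cut-off: a sharp one works for p = 2, while p = 1 uses smooth ones
(`integrable_fourierInv_fourier_mul`) and a limit. -/

/-! ### The L² Fourier transform and the Fourier integral -/

theorem continuous_fourier_of_integrable {h : ℝ → ℂ} (h1 : Integrable h) : Continuous (𝓕 h) :=
  VectorFourier.fourierIntegral_continuous Real.continuous_fourierChar
    continuous_inner h1

/-- It suffices to pair both sides with test functions. The L² transform agrees with that of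
tempered distributions, and the Fourier integral obeys the same duality ∫ ψ̂ h = ∫ ψ ĥ. -/
theorem coeFn_fourier_toLp_ae_eq {h : ℝ → ℂ} (h1 : Integrable h) (h2 : MemLp h 2) :
    ((𝓕 (h2.toLp h) : Lp ℂ 2 (volume : Measure ℝ)) : ℝ → ℂ) =ᵐ[volume] 𝓕 h := by
  refine ae_eq_of_integral_contDiff_smul_eq
    ((Lp.memLp _).locallyIntegrable (by norm_num))
    (continuous_fourier_of_integrable h1).locallyIntegrable ?_
  intro g hg hgs
  have hs : HasCompactSupport (fun x => (g x : ℂ)) := hgs.comp_left (g := Complex.ofReal) rfl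
  have hd : ContDiff ℝ ∞ (fun x => (g x : ℂ)) := Complex.ofRealCLM.contDiff.comp hg
  let ψ := hs.toSchwartzMap hd
  have key := congr($(Lp.fourier_toTemperedDistribution_eq (h2.toLp h)) ψ)
  simp only [TemperedDistribution.fourier_apply, Lp.toTemperedDistribution_apply] at key
  have e1 : ∫ x, (𝓕 ψ) x • (h2.toLp h) x = ∫ x, (𝓕 ψ) x • h x := by
    refine integral_congr_ae ?_
    filter_upwards [h2.coeFn_toLp] with x hx
    rw [hx]
  have e2 : ∫ x, (𝓕 (ψ : ℝ → ℂ)) x • h x = ∫ x, (ψ : ℝ → ℂ) x • 𝓕 h x := by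
    simpa using! (VectorFourier.integral_fourierIntegral_smul_eq_flip (L := innerₗ ℝ)
      Real.continuous_fourierChar continuous_inner (ψ.integrable (μ := volume)) h1)
  rw [e1, SchwartzMap.fourier_coe, e2] at key
  simpa [ψ, Complex.real_smul] using! key.symm

theorem coeFn_fourierInv_toLp_ae_eq {h : ℝ → ℂ} (h1 : Integrable h) (h2 : MemLp h 2) :
    ((𝓕⁻ (h2.toLp h) : Lp ℂ 2 (volume : Measure ℝ)) : ℝ → ℂ) =ᵐ[volume] 𝓕⁻ h := by
  have hc : Continuous (𝓕⁻ h) := by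
    have : 𝓕⁻ h = fun w => 𝓕 h (-w) := by
      ext w; exact Real.fourierInv_eq_fourier_neg h w
    rw [this]
    exact (continuous_fourier_of_integrable h1).comp continuous_neg
  refine ae_eq_of_integral_contDiff_smul_eq
    ((Lp.memLp _).locallyIntegrable (by norm_num)) hc.locallyIntegrable ?_
  intro g hg hgs
  have hs : HasCompactSupport (fun x => (g x : ℂ)) := hgs.comp_left (g := Complex.ofReal) rfl
  have hd : ContDiff ℝ ∞ (fun x => (g x : ℂ)) := Complex.ofRealCLM.contDiff.comp hg
  let ψ := hs.toSchwartzMap hd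
  have key := congr($(Lp.fourierInv_toTemperedDistribution_eq (h2.toLp h)) ψ)
  simp only [TemperedDistribution.fourierInv_apply, Lp.toTemperedDistribution_apply] at key
  have e1 : ∫ x, (𝓕⁻ ψ) x • (h2.toLp h) x = ∫ x, (𝓕⁻ ψ) x • h x := by
    refine integral_congr_ae ?_
    filter_upwards [h2.coeFn_toLp] with x hx
    rw [hx]
  have e2 : ∫ x, (𝓕⁻ (ψ : ℝ → ℂ)) x • h x = ∫ x, (ψ : ℝ → ℂ) x • 𝓕⁻ h x := by
    have hflip : (-innerₗ ℝ).flip = -innerₗ ℝ := by ext; simp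
    have := VectorFourier.integral_fourierIntegral_smul_eq_flip (L := -innerₗ ℝ)
      Real.continuous_fourierChar continuous_inner.neg (ψ.integrable (μ := volume)) h1
    rwa [hflip] at this
  rw [e1, SchwartzMap.fourierInv_coe, e2] at key
  simpa [ψ, Complex.real_smul] using! key.symm

theorem eLpNorm_fourier_eq {h : ℝ → ℂ} (h1 : Integrable h) (h2 : MemLp h 2) :
    eLpNorm (𝓕 h) 2 volume = eLpNorm h 2 volume := by
  rw [← eLpNorm_congr_ae (coeFn_fourier_toLp_ae_eq h1 h2), ← Lp.enorm_def,
    ← eLpNorm_congr_ae h2.coeFn_toLp, ← Lp.enorm_def, ← ofReal_norm, ← ofReal_norm,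
    Lp.norm_fourier_eq]

theorem memLp_fourierInv {h : ℝ → ℂ} (h1 : Integrable h) (h2 : MemLp h 2) :
    MemLp (𝓕⁻ h) 2 :=
  (memLp_congr_ae (coeFn_fourierInv_toLp_ae_eq h1 h2)).1 (Lp.memLp _)

/-- If `h` is continuous and square integrable and its `L²` Fourier transform is represented by an
integrable function `m`, then the inversion formula holds pointwise. -/
theorem fourierInv_eq_of_fourier_toLp_ae_eq {h m : ℝ → ℂ} (hc : Continuous h) (h2 : MemLp h 2)
    (hm : Integrable m)
    (e : ((𝓕 (h2.toLp h) : Lp ℂ 2 (volume : Measure ℝ)) : ℝ → ℂ) =ᵐ[volume] m) :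
    𝓕⁻ m = h := by
  have m2 : MemLp m 2 := (memLp_congr_ae e).1 (Lp.memLp _)
  have e1 : m2.toLp m = 𝓕 (h2.toLp h) := by
    apply Lp.ext
    exact m2.coeFn_toLp.trans e.symm
  have e2 := coeFn_fourierInv_toLp_ae_eq hm m2
  rw [e1, FourierTransform.fourierInv_fourier_eq] at e2
  have hc' : Continuous (𝓕⁻ m) := by
    have : 𝓕⁻ m = fun w => 𝓕 m (-w) := by
      ext w; exact Real.fourierInv_eq_fourier_neg m w
    rw [this]
    exact (continuous_fourier_of_integrable hm).comp continuous_neg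
  exact (Continuous.ae_eq_iff_eq volume hc' hc).1 (e2.symm.trans h2.coeFn_toLp)

/-! ### Logarithmic coordinates -/

/-- The function `z ↦ e^{cz} f(e^{Re z}, Im z)`, that is, `f` in logarithmic coordinates with the
weight `r^c`. -/
noncomputable def logCoord (c : ℝ) (f : ℝ × ℝ → ℂ) (z : ℂ) : ℂ :=
  Complex.exp (c * z) * f (Real.exp z.re, z.im)

theorem polarPoint_exp (z : ℂ) : polarPoint (Real.exp z.re, z.im) = Complex.exp z := by
  rw [polarPoint, Complex.ofReal_exp, ← Complex.exp_add, Complex.re_add_im]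

/-- Under z ↦ (e^{Re z}, Im z) the point r e^{iθ} becomes e^z. The polar difference quotient times
the slope of `exp` is then an ordinary complex difference quotient. -/
theorem differentiableAt_logCoord {a c : ℝ} {f : ℝ × ℝ → ℂ}
    (hf : PolarAnalyticOn f (polarStrip a)) {z₀ : ℂ} (h1 : -a < z₀.im) (h2 : z₀.im < a) :
    DifferentiableAt ℂ (logCoord c f) z₀ := by
  obtain ⟨d, hd⟩ := hf (Real.exp z₀.re, z₀.im) ⟨Real.exp_pos _, h1, h2⟩
  have hexp := Complex.hasDerivAt_exp z₀
  have hmap : Tendsto (fun z : ℂ => (Real.exp z.re, z.im)) (𝓝[≠] z₀)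
      (𝓝[polarStrip a \ {(Real.exp z₀.re, z₀.im)}] (Real.exp z₀.re, z₀.im)) := by
    refine tendsto_nhdsWithin_iff.2 ⟨?_, ?_⟩
    · refine Tendsto.mono_left ?_ nhdsWithin_le_nhds
      exact (Continuous.prodMk (Real.continuous_exp.comp Complex.continuous_re)
        Complex.continuous_im).tendsto z₀
    · have o : ∀ᶠ z : ℂ in 𝓝 z₀, -a < z.im ∧ z.im < a :=
        ((isOpen_lt continuous_const Complex.continuous_im).inter
          (isOpen_lt Complex.continuous_im continuous_const)).mem_nhds ⟨h1, h2⟩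
      filter_upwards [nhdsWithin_le_nhds o, self_mem_nhdsWithin] with z hz hne
      refine ⟨⟨Real.exp_pos _, hz.1, hz.2⟩, fun h => hne ?_⟩
      simp only [mem_singleton_iff, Prod.mk.injEq, Real.exp_eq_exp] at h
      exact Complex.ext h.1 h.2
  have hg : HasDerivAt (fun z : ℂ => f (Real.exp z.re, z.im)) (d * Complex.exp z₀) z₀ := by
    rw [hasDerivAt_iff_tendsto_slope]
    refine ((hd.comp hmap).mul (hasDerivAt_iff_tendsto_slope.1 hexp)).congr' ?_
    filter_upwards [hexp.eventually_ne (c := Complex.exp z₀) (Complex.exp_ne_zero _)] with z hz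
    simp only [Function.comp, slope_def_field, polarPoint_exp]
    rw [div_mul_div_cancel₀ (sub_ne_zero.2 hz)]
  exact ((Complex.differentiable_exp.comp
    (differentiable_id.const_mul (c : ℂ))).differentiableAt).mul hg.differentiableAt

/-- Here the slope of `G` is divided by the slope of `exp`, both in the variable log r + iθ. That
variable is injective on the half-plane because θ is not reduced modulo 2π, so punctured
neighbourhoods map to punctured neighbourhoods. -/
theorem polarAnalyticOn_of_differentiable {G : ℂ → ℂ} (hG : Differentiable ℂ G) :
    PolarAnalyticOn (fun x => G (Real.log x.1 + x.2 * Complex.I)) polarPlane := by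
  intro x₀ hx₀
  have hx₀' : 0 < x₀.1 := hx₀
  set ℓ : ℝ × ℝ → ℂ := fun x => Real.log x.1 + x.2 * Complex.I with hℓ
  have hre : ∀ x, (ℓ x).re = Real.log x.1 := fun x => by simp [hℓ]
  have him : ∀ x, (ℓ x).im = x.2 := fun x => by simp [hℓ]
  have hpol : ∀ x : ℝ × ℝ, 0 < x.1 → polarPoint x = Complex.exp (ℓ x) := fun x hx => by
    rw [← polarPoint_exp, hre, him, Real.exp_log hx]
  have hmap : Tendsto ℓ (𝓝[polarPlane \ {x₀}] x₀) (𝓝[≠] (ℓ x₀)) := by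
    refine tendsto_nhdsWithin_iff.2 ⟨?_, ?_⟩
    · refine Tendsto.mono_left ?_ nhdsWithin_le_nhds
      have : ContinuousAt (fun x : ℝ × ℝ => Real.log x.1) x₀ :=
        continuousAt_fst.log hx₀'.ne'
      exact ((Complex.continuous_ofReal.continuousAt.comp this).add
        ((Complex.continuous_ofReal.comp continuous_snd).mul continuous_const).continuousAt)
    · filter_upwards [self_mem_nhdsWithin] with x hx h
      have hx1 : 0 < x.1 := hx.1
      refine hx.2 (Prod.ext ?_ ?_)
      · have := congrArg Complex.re h
        rw [hre, hre] at this
        exact Real.log_injOn_pos hx1 hx₀' this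
      · have := congrArg Complex.im h
        rwa [him, him] at this
  have hexp := hasDerivAt_iff_tendsto_slope.1 (Complex.hasDerivAt_exp (ℓ x₀))
  have hGd := hasDerivAt_iff_tendsto_slope.1 (hG (ℓ x₀)).hasDerivAt
  refine ⟨_, ((hGd.div hexp (Complex.exp_ne_zero _)).comp hmap).congr' ?_⟩
  have hne : ∀ᶠ x in 𝓝[polarPlane \ {x₀}] x₀, ℓ x ≠ ℓ x₀ :=
    hmap.eventually self_mem_nhdsWithin
  filter_upwards [self_mem_nhdsWithin, hne] with x hx hn
  simp only [Function.comp, Pi.div_apply, slope_def_field]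
  rw [hpol x hx.1, hpol x₀ hx₀', div_div_div_cancel_right₀ (sub_ne_zero.2 hn)]

/-- Substituting r = e^t, the Jacobian e^t cancels the factor r^{-1} left by the weight r^{c-1/p}
after taking p-th powers. -/
theorem mellinXNorm_eq_eLpNorm {p : ℝ} (hp : 1 ≤ p) (c : ℝ) (φ : ℝ → ℂ) :
    mellinXNorm p c φ =
      eLpNorm (fun t : ℝ => Complex.exp (c * t) * φ (Real.exp t)) (ENNReal.ofReal p) volume := by
  have hp0 : 0 < p := by linarith
  have h0 : ENNReal.ofReal p ≠ 0 := by simpa using hp0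
  rw [mellinXNorm, eLpNorm_eq_lintegral_rpow_enorm_toReal h0 ENNReal.ofReal_ne_top,
    eLpNorm_eq_lintegral_rpow_enorm_toReal h0 ENNReal.ofReal_ne_top, ENNReal.toReal_ofReal hp0.le]
  congr 1
  have hi : Real.exp '' univ = Ioi 0 := by rw [image_univ, Real.range_exp]
  rw [← hi, lintegral_image_eq_lintegral_abs_deriv_mul MeasurableSet.univ
    (fun x _ => (Real.hasDerivAt_exp x).hasDerivWithinAt) Real.exp_injective.injOn,
    Measure.restrict_univ]
  refine lintegral_congr fun t => ?_
  rw [abs_of_pos (Real.exp_pos t), mellinWeight, enorm_mul, enorm_mul,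
    ENNReal.mul_rpow_of_nonneg _ _ hp0.le, ENNReal.mul_rpow_of_nonneg _ _ hp0.le, ← mul_assoc]
  congr 1
  rw [← ofReal_norm, ← ofReal_norm, ENNReal.ofReal_rpow_of_nonneg (norm_nonneg _) hp0.le,
    ENNReal.ofReal_rpow_of_nonneg (norm_nonneg _) hp0.le, ← ENNReal.ofReal_mul (Real.exp_pos t).le]
  congr 1
  rw [Complex.norm_real, Real.norm_of_nonneg (by positivity), Complex.norm_exp, ← Real.exp_mul,
    ← Real.exp_mul, ← Real.exp_mul, ← Real.exp_add]
  congr 1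
  have : ((c : ℂ) * t).re = c * t := by simp
  rw [this]
  field_simp
  ring

theorem aestronglyMeasurable_mellinWeight {p c : ℝ} {φ : ℝ → ℂ} (hφ : ContinuousOn φ (Ioi 0)) :
    AEStronglyMeasurable (mellinWeight p c φ) (volume.restrict (Ioi 0)) := by
  refine ContinuousOn.aestronglyMeasurable ?_ measurableSet_Ioi
  refine ContinuousOn.mul ?_ hφ
  refine Complex.continuous_ofReal.comp_continuousOn ?_
  exact fun x hx => (Real.continuousAt_rpow_const _ _ (Or.inl hx.ne')).continuousWithinAt

/-! ### Shifting the line of integration -/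

/-- Two horizontal line integrals of a function holomorphic in the strip between the lines agree
if the function is integrable on each line, with a common bound for the `L¹` norms. -/
theorem integral_horizontal_line_eq {F : ℂ → ℂ} {θ : ℝ}
    (hF : ∀ z : ℂ, z.im ∈ uIcc 0 θ → DifferentiableAt ℂ F z) {B : ℝ≥0∞} (hB : B ≠ ⊤)
    (hb : ∀ y ∈ uIcc 0 θ, ∫⁻ t : ℝ, ‖F (t + y * Complex.I)‖ₑ ≤ B)
    (h0 : Integrable fun t : ℝ => F t) (hθ : Integrable fun t : ℝ => F (t + θ * Complex.I)) :
    ∫ t : ℝ, F t = ∫ t : ℝ, F (t + θ * Complex.I) := by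
  -- No pointwise decay on the vertical sides is available. By Cauchy the truncated difference `D R`
  -- is at most the vertical integrals at ±R, whose integral over R is finite by Tonelli. A nonzero
  -- limit of `D` would keep them above some e > 0 for all large R, making that integral infinite.
  by_contra hne
  have hcont : ∀ z : ℂ, z.im ∈ uIcc 0 θ → ContinuousAt F z := fun z hz => (hF z hz).continuousAt
  have hsub : uIoc 0 θ ⊆ uIcc 0 θ := uIoc_subset_uIcc
  set k : ℝ → ℝ → ℝ≥0∞ := fun R y =>
    ‖F (R + y * Complex.I)‖ₑ + ‖F ((-R : ℝ) + y * Complex.I)‖ₑ with hk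
  set D : ℝ → ℂ := fun R => (∫ x in -R..R, F x) - ∫ x in -R..R, F (x + θ * Complex.I) with hD
  have hvert : ∀ R : ℝ, ContinuousOn (fun y : ℝ => F (R + y * Complex.I)) (uIcc 0 θ) := by
    intro R y hy
    refine ContinuousAt.continuousWithinAt ?_
    exact ContinuousAt.comp (f := fun y : ℝ => (R : ℂ) + y * Complex.I) (g := F)
      (hcont _ (by simpa using hy)) (by fun_prop)
  have hvm : ∀ R : ℝ, AEMeasurable (fun y : ℝ => ‖F (R + y * Complex.I)‖ₑ)
      (volume.restrict (uIoc 0 θ)) := fun R =>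
    (((hvert R).mono hsub).aestronglyMeasurable measurableSet_uIoc).enorm
  have hDle : ∀ R, ‖D R‖ₑ ≤ ∫⁻ y in uIoc 0 θ, k R y := by
    intro R
    have hc := Complex.integral_boundary_rect_eq_zero_of_differentiableOn F (-R : ℝ)
      (R + θ * Complex.I) (fun z hz => by
        refine (hF z ?_).differentiableWithinAt
        simpa using hz.2)
    simp only [Complex.ofReal_re, Complex.ofReal_im, Complex.add_re, Complex.add_im,
      Complex.mul_re, Complex.mul_im, Complex.I_re, Complex.I_im, mul_zero, mul_one, sub_zero,
      add_zero, zero_add, Complex.ofReal_zero, zero_mul] at hc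
    have hD' : D R = Complex.I * (∫ y in (0 : ℝ)..θ, F ((-R : ℝ) + y * Complex.I)) -
        Complex.I * (∫ y in (0 : ℝ)..θ, F (R + y * Complex.I)) := by
      simp only [smul_eq_mul] at hc
      rw [hD]
      linear_combination hc
    have hE : ∀ S : ℝ, ‖Complex.I * ∫ y in (0 : ℝ)..θ, F (S + y * Complex.I)‖ₑ ≤
        ∫⁻ y in uIoc 0 θ, ‖F (S + y * Complex.I)‖ₑ := by
      intro S
      rw [enorm_mul, show ‖Complex.I‖ₑ = 1 by simp [← ofReal_norm], one_mul, ← ofReal_norm,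
        intervalIntegral.norm_intervalIntegral_eq, ofReal_norm]
      exact enorm_integral_le_lintegral_enorm _
    rw [hD', hk, lintegral_add_left' (hvm R), add_comm]
    exact (enorm_sub_le).trans (add_le_add (hE (-R)) (hE R))
  have hlim : Tendsto D atTop (𝓝 ((∫ t : ℝ, F t) - ∫ t : ℝ, F (t + θ * Complex.I))) :=
    (intervalIntegral_tendsto_integral h0 tendsto_neg_atTop_atBot tendsto_id).sub
      (intervalIntegral_tendsto_integral hθ tendsto_neg_atTop_atBot tendsto_id)
  have hpos : 0 < ‖(∫ t : ℝ, F t) - ∫ t : ℝ, F (t + θ * Complex.I)‖ₑ := by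
    simpa [sub_eq_zero] using hne
  obtain ⟨e, he0, he⟩ := exists_between hpos
  have hlim' := ((continuous_enorm (E := ℂ)).tendsto _).comp hlim
  obtain ⟨R₀, hR₀⟩ := eventually_atTop.1 (hlim'.eventually (lt_mem_nhds he))
  have hfin : ∫⁻ R : ℝ, ∫⁻ y in uIoc 0 θ, k R y < ⊤ := by
    have hmeas : AEMeasurable (Function.uncurry k)
        (volume.prod (volume.restrict (uIoc 0 θ))) := by
      have hS : MeasurableSet ((univ : Set ℝ) ×ˢ uIoc 0 θ) :=
        MeasurableSet.univ.prod measurableSet_uIoc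
      have hr : volume.prod (volume.restrict (uIoc 0 θ)) =
          ((volume : Measure ℝ).prod volume).restrict ((univ : Set ℝ) ×ˢ uIoc 0 θ) := by
        rw [← Measure.prod_restrict, Measure.restrict_univ]
      rw [hr]
      refine ContinuousOn.aemeasurable ?_ hS
      intro x hx
      refine ContinuousAt.continuousWithinAt ?_
      have hx2 : x.2 ∈ uIcc 0 θ := hsub hx.2
      have h1 : ContinuousAt (fun x : ℝ × ℝ => F (x.1 + x.2 * Complex.I)) x :=
        ContinuousAt.comp (f := fun x : ℝ × ℝ => (x.1 : ℂ) + x.2 * Complex.I) (g := F)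
          (hcont _ (by simpa using hx2)) (by fun_prop)
      have h2 : ContinuousAt (fun x : ℝ × ℝ => F ((-x.1 : ℝ) + x.2 * Complex.I)) x :=
        ContinuousAt.comp (f := fun x : ℝ × ℝ => ((-x.1 : ℝ) : ℂ) + x.2 * Complex.I)
          (g := F) (hcont _ (by simpa using hx2)) (by fun_prop)
      exact (continuous_enorm.continuousAt.comp h1).add (continuous_enorm.continuousAt.comp h2)
    rw [lintegral_lintegral_swap hmeas]
    calc ∫⁻ y in uIoc 0 θ, ∫⁻ R : ℝ, k R y
        ≤ ∫⁻ _y in uIoc 0 θ, (B + B) := by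
          refine setLIntegral_mono' measurableSet_uIoc fun y hy => ?_
          have hm : Measurable fun R : ℝ => ‖F (R + y * Complex.I)‖ₑ := by
            refine Continuous.measurable ?_
            refine Continuous.enorm (continuous_iff_continuousAt.2 fun t => ?_)
            exact ContinuousAt.comp (f := fun t : ℝ => (t : ℂ) + y * Complex.I) (g := F)
              (hcont _ (by simpa using hsub hy)) (by fun_prop)
          simp only [hk]
          rw [lintegral_add_left hm,
            lintegral_neg_eq_self (fun R : ℝ => ‖F (R + y * Complex.I)‖ₑ)]
          exact add_le_add (hb y (hsub hy)) (hb y (hsub hy))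
      _ < ⊤ := by
          rw [setLIntegral_const]
          refine ENNReal.mul_lt_top (ENNReal.add_lt_top.2 ⟨hB.lt_top, hB.lt_top⟩) ?_
          rw [Real.volume_uIoc]
          exact ENNReal.ofReal_lt_top
  refine hfin.ne (top_unique ?_)
  calc (⊤ : ℝ≥0∞) = ∫⁻ _R in Ioi R₀, e := by
        rw [setLIntegral_const, Real.volume_Ioi, ENNReal.mul_top he0.ne']
    _ ≤ ∫⁻ R in Ioi R₀, ∫⁻ y in uIoc 0 θ, k R y :=
        setLIntegral_mono' measurableSet_Ioi fun R hR =>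
          (hR₀ R (le_of_lt hR)).le.trans (hDle R)
    _ ≤ _ := setLIntegral_le_lintegral _ _


/-- The contour shift is applied to e^{-2πiwz} F(z). At height y the exponential has constant
modulus e^{2πwy}, so uniform L¹ bounds survive. -/
theorem fourier_eq_exp_mul_fourier_horizontal {F : ℂ → ℂ} {θ : ℝ}
    (hF : ∀ z : ℂ, z.im ∈ uIcc 0 θ → DifferentiableAt ℂ F z) {B : ℝ≥0∞} (hB : B ≠ ⊤)
    (hb : ∀ y ∈ uIcc 0 θ, ∫⁻ t : ℝ, ‖F (t + y * Complex.I)‖ₑ ≤ B) (w : ℝ) :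
    𝓕 (fun t : ℝ => F t) w =
      Real.exp (2 * Real.pi * θ * w) * 𝓕 (fun t : ℝ => F (t + θ * Complex.I)) w := by
  set E : ℂ → ℂ := fun z => Complex.exp (-2 * Real.pi * w * Complex.I * z) with hE
  have hEd : Differentiable ℂ E := by fun_prop
  have hEn : ∀ t y : ℝ, ‖E (t + y * Complex.I)‖ₑ = ENNReal.ofReal (Real.exp (2 * Real.pi * w * y)) := by
    intro t y
    rw [← ofReal_norm, hE, Complex.norm_exp]
    congr 2
    simp
  have hcont : ∀ y ∈ uIcc 0 θ, Continuous fun t : ℝ => F (t + y * Complex.I) := fun y hy =>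
    continuous_iff_continuousAt.2 fun t =>
      ContinuousAt.comp (f := fun t : ℝ => (t : ℂ) + y * Complex.I) (g := F)
        (hF _ (by simpa using hy)).continuousAt (by fun_prop)
  have hbE : ∀ y ∈ uIcc 0 θ, ∫⁻ t : ℝ, ‖E (t + y * Complex.I) * F (t + y * Complex.I)‖ₑ ≤
      ENNReal.ofReal (Real.exp (2 * Real.pi * |w| * |θ|)) * B := by
    intro y hy
    simp_rw [enorm_mul, hEn]
    rw [lintegral_const_mul _ (hcont y hy).enorm.measurable]
    refine mul_le_mul' (ENNReal.ofReal_le_ofReal (Real.exp_le_exp.2 ?_)) ?_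
    · calc 2 * Real.pi * w * y ≤ |2 * Real.pi * w * y| := le_abs_self _
        _ = 2 * Real.pi * |w| * |y| := by
          rw [abs_mul, abs_mul, abs_of_pos Real.two_pi_pos]
        _ ≤ 2 * Real.pi * |w| * |θ| := by
          have : |y| ≤ |θ| := by simpa using abs_sub_left_of_mem_uIcc hy
          gcongr
    · exact hb y hy
  have hBE : ENNReal.ofReal (Real.exp (2 * Real.pi * |w| * |θ|)) * B ≠ ⊤ :=
    ENNReal.mul_ne_top ENNReal.ofReal_ne_top hB
  have hint : ∀ y ∈ uIcc 0 θ,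
      Integrable fun t : ℝ => E (t + y * Complex.I) * F (t + y * Complex.I) := by
    intro y hy
    refine ⟨Continuous.aestronglyMeasurable ?_, lt_of_le_of_lt (hbE y hy) hBE.lt_top⟩
    exact (hEd.continuous.comp (by fun_prop)).mul (hcont y hy)
  have key := integral_horizontal_line_eq (F := fun z => E z * F z) (θ := θ)
    (fun z hz => (hEd z).mul (hF z hz)) hBE hbE (by simpa using hint 0 left_mem_uIcc)
    (hint θ right_mem_uIcc)
  rw [Real.fourier_real_eq_integral_exp_smul, Real.fourier_real_eq_integral_exp_smul,
    ← integral_const_mul]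
  convert key using 1
  · refine integral_congr_ae (Eventually.of_forall fun t => ?_)
    simp only [hE, smul_eq_mul]
    congr 2
    push_cast
    ring
  · refine integral_congr_ae (Eventually.of_forall fun t => ?_)
    simp only [hE, smul_eq_mul]
    rw [← mul_assoc, Complex.ofReal_exp, ← Complex.exp_add]
    congr 2
    push_cast
    linear_combination (2 * Real.pi * w * θ) * Complex.I_sq

/-! ### Exponential decay of Fourier transforms on a strip -/

theorem lintegral_le_of_tendsto_ae {α : Type*} [MeasurableSpace α] {μ : Measure α}
    {u : ℕ → α → ℝ≥0∞} {v : α → ℝ≥0∞} {C : ℕ → ℝ≥0∞} {C' : ℝ≥0∞}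
    (hu : ∀ n, AEMeasurable (u n) μ)
    (hv : ∀ᵐ x ∂μ, Tendsto (fun n => u n x) atTop (𝓝 (v x)))
    (hC : ∀ n, ∫⁻ x, u n x ∂μ ≤ C n) (hC' : Tendsto C atTop (𝓝 C')) : ∫⁻ x, v x ∂μ ≤ C' :=
  calc ∫⁻ x, v x ∂μ = ∫⁻ x, liminf (fun n => u n x) atTop ∂μ :=
        lintegral_congr_ae (hv.mono fun _ hx => hx.liminf_eq.symm)
    _ ≤ liminf (fun n => ∫⁻ x, u n x ∂μ) atTop := lintegral_liminf_le' hu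
    _ ≤ liminf C atTop := liminf_le_liminf (Eventually.of_forall hC)
    _ = C' := hC'.liminf_eq

theorem lintegral_enorm_sq_eq {α : Type*} [MeasurableSpace α] {μ : Measure α} (h : α → ℂ) :
    ∫⁻ x, ‖h x‖ₑ ^ 2 ∂μ = eLpNorm h 2 μ ^ 2 := by
  have := eLpNorm_nnreal_pow_eq_lintegral (μ := μ) (f := h) (p := 2) two_ne_zero
  simpa using this.symm

theorem enorm_fourier_le (h : ℝ → ℂ) (w : ℝ) : ‖𝓕 h w‖ₑ ≤ ∫⁻ t, ‖h t‖ₑ := by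
  rw [Real.fourier_real_eq]
  refine (enorm_integral_le_lintegral_enorm _).trans (le_of_eq ?_)
  refine lintegral_congr fun t => ?_
  rw [← ofReal_norm, Circle.norm_smul, ofReal_norm]

theorem continuous_horizontal {F : ℂ → ℂ} {a y : ℝ} (hy : y ∈ Ioo (-a) a)
    (hF : ∀ z : ℂ, z.im ∈ Ioo (-a) a → DifferentiableAt ℂ F z) :
    Continuous fun t : ℝ => F (t + y * Complex.I) :=
  continuous_iff_continuousAt.2 fun t =>
    ContinuousAt.comp (f := fun t : ℝ => (t : ℂ) + y * Complex.I) (g := F)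
      (hF _ (by simpa using hy)).continuousAt (by fun_prop)

theorem uIcc_zero_subset_Ioo {a θ : ℝ} (hθ : θ ∈ Ioo (-a) a) : uIcc 0 θ ⊆ Ioo (-a) a := by
  have ha : 0 < a := by linarith [hθ.1, hθ.2]
  exact ordConnected_Ioo.uIcc_subset ⟨by linarith, ha⟩ hθ

/-- Shifting to height -b for w ≥ 0 and to b for w ≤ 0 gains e^{-2πb|w|}; then b tends to a. Only
the sum of the two norms at ±b is controlled, so each one is bounded by 2N, which is the source of
the factor 2. -/
theorem norm_fourier_le_of_strip {F : ℂ → ℂ} {a N : ℝ} (ha : 0 < a) (hN0 : 0 ≤ N)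
    (hF : ∀ z : ℂ, z.im ∈ Ioo (-a) a → DifferentiableAt ℂ F z)
    (h0 : Integrable fun t : ℝ => F t)
    (hN : ∀ b ∈ Ioo 0 a, (∫⁻ t : ℝ, ‖F (t + b * Complex.I)‖ₑ) +
      ∫⁻ t : ℝ, ‖F (t + (-b : ℝ) * Complex.I)‖ₑ ≤ 2 * ENNReal.ofReal N) (w : ℝ) :
    ‖𝓕 (fun t : ℝ => F t) w‖ ≤ 2 * N * Real.exp (-(2 * Real.pi * a * |w|)) := by
  have hN' : ∀ y ∈ Ioo (-a) a, y ≠ 0 →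
      ∫⁻ t : ℝ, ‖F (t + y * Complex.I)‖ₑ ≤ 2 * ENNReal.ofReal N := by
    intro y hy hy0
    rcases lt_or_gt_of_ne hy0 with h | h
    · have := hN (-y) ⟨by linarith, by linarith [hy.1]⟩
      rw [neg_neg] at this
      exact le_add_self.trans this
    · exact le_self_add.trans (hN y ⟨h, hy.2⟩)
  -- The hypothesis `hN` excludes height 0, so the norm on the real line is added to obtain a bound
  -- uniform over the strip.
  set B : ℝ≥0∞ := 2 * ENNReal.ofReal N + ∫⁻ t : ℝ, ‖F t‖ₑ with hB
  have hBt : B ≠ ⊤ :=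
    ENNReal.add_ne_top.2 ⟨ENNReal.mul_ne_top (by norm_num) ENNReal.ofReal_ne_top, h0.2.ne⟩
  have hBb : ∀ y ∈ Ioo (-a) a, ∫⁻ t : ℝ, ‖F (t + y * Complex.I)‖ₑ ≤ B := by
    intro y hy
    by_cases hy0 : y = 0
    · subst hy0
      simp [hB]
    · exact (hN' y hy hy0).trans le_self_add
  have main : ∀ θ ∈ Ioo (-a) a, θ ≠ 0 →
      ‖𝓕 (fun t : ℝ => F t) w‖ ≤ Real.exp (2 * Real.pi * θ * w) * (2 * N) := by
    intro θ hθ hθ0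
    have hs := uIcc_zero_subset_Ioo hθ
    rw [fourier_eq_exp_mul_fourier_horizontal (fun z hz => hF z (hs hz)) hBt
      (fun y hy => hBb y (hs hy)) w, norm_mul, Complex.norm_real, Real.norm_of_nonneg
      (Real.exp_pos _).le]
    gcongr
    have h2 : (0 : ℝ) ≤ 2 * N := by positivity
    rw [← ENNReal.ofReal_le_ofReal_iff h2, ofReal_norm]
    refine (enorm_fourier_le _ _).trans ((hN' θ hθ hθ0).trans (le_of_eq ?_))
    rw [ENNReal.ofReal_mul zero_le_two, ENNReal.ofReal_ofNat]
  have main2 : ∀ b ∈ Ioo 0 a,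
      ‖𝓕 (fun t : ℝ => F t) w‖ ≤ Real.exp (2 * Real.pi * (-b) * |w|) * (2 * N) := by
    intro b hb
    rcases le_total 0 w with hw | hw
    · rw [abs_of_nonneg hw]
      exact main (-b) ⟨by linarith [hb.2], by linarith [hb.1, hb.2]⟩ (by linarith [hb.1])
    · rw [abs_of_nonpos hw]
      refine (main b ⟨by linarith [hb.1], hb.2⟩ hb.1.ne').trans (le_of_eq ?_)
      congr 2
      ring
  have hlim : Tendsto (fun b : ℝ => Real.exp (2 * Real.pi * (-b) * |w|) * (2 * N)) (𝓝[<] a)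
      (𝓝 (Real.exp (2 * Real.pi * (-a) * |w|) * (2 * N))) := by
    refine Tendsto.mono_left ?_ nhdsWithin_le_nhds
    refine Continuous.tendsto ?_ a
    fun_prop
  have := ge_of_tendsto hlim (by
    filter_upwards [Ioo_mem_nhdsLT ha] with b hb
    exact main2 b hb)
  refine this.trans (le_of_eq ?_)
  rw [mul_comm]
  congr 2
  ring

/-- By Plancherel the lines at heights ±b contribute the weights e^{∓4πbw}. For every w one of the
two equals e^{4πb|w|}. -/
theorem lintegral_fourier_sq_mul_exp_le {G : ℂ → ℂ} {a b : ℝ} (hb : b ∈ Ioo 0 a)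
    (hG : ∀ z : ℂ, z.im ∈ Ioo (-a) a → DifferentiableAt ℂ G z) {B : ℝ≥0∞} (hB : B ≠ ⊤)
    (hGB : ∀ y ∈ Ioo (-a) a, ∫⁻ t : ℝ, ‖G (t + y * Complex.I)‖ₑ ≤ B)
    (hG2 : ∀ y ∈ Ioo (-a) a, MemLp (fun t : ℝ => G (t + y * Complex.I)) 2) :
    ∫⁻ w, ‖𝓕 (fun t : ℝ => G t) w‖ₑ ^ 2 * ENNReal.ofReal (Real.exp (4 * Real.pi * b * |w|)) ≤
      (∫⁻ t : ℝ, ‖G (t + b * Complex.I)‖ₑ ^ 2) +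
        ∫⁻ t : ℝ, ‖G (t + (-b : ℝ) * Complex.I)‖ₑ ^ 2 := by
  have hb1 : b ∈ Ioo (-a) a := ⟨by linarith [hb.1, hb.2], hb.2⟩
  have hb2 : -b ∈ Ioo (-a) a := ⟨by linarith [hb.2], by linarith [hb.1, hb.2]⟩
  have hint : ∀ y ∈ Ioo (-a) a, Integrable fun t : ℝ => G (t + y * Complex.I) := fun y hy =>
    ⟨(continuous_horizontal hy hG).aestronglyMeasurable, (hGB y hy).trans_lt hB.lt_top⟩
  have hpl : ∀ y ∈ Ioo (-a) a, ∫⁻ t : ℝ, ‖G (t + y * Complex.I)‖ₑ ^ 2 =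
      ∫⁻ w, ‖𝓕 (fun t : ℝ => G (t + y * Complex.I)) w‖ₑ ^ 2 := by
    intro y hy
    rw [lintegral_enorm_sq_eq, lintegral_enorm_sq_eq, eLpNorm_fourier_eq (hint y hy) (hG2 y hy)]
  have hsh : ∀ y ∈ Ioo (-a) a, ∀ w : ℝ, ‖𝓕 (fun t : ℝ => G (t + y * Complex.I)) w‖ₑ =
      ENNReal.ofReal (Real.exp (-(2 * Real.pi * y * w))) * ‖𝓕 (fun t : ℝ => G t) w‖ₑ := by
    intro y hy w
    have hs := uIcc_zero_subset_Ioo hy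
    rw [fourier_eq_exp_mul_fourier_horizontal (fun z hz => hG z (hs hz)) hB
      (fun y hy => hGB y (hs hy)) w, enorm_mul, ← mul_assoc]
    rw [← ofReal_norm (Complex.ofReal _), Complex.norm_real, Real.norm_of_nonneg
      (Real.exp_pos _).le, ← ENNReal.ofReal_mul (Real.exp_pos _).le, ← Real.exp_add]
    simp
  rw [hpl b hb1, hpl (-b) hb2, ← lintegral_add_left
    ((continuous_fourier_of_integrable (hint b hb1)).enorm.measurable.pow_const 2)]
  refine lintegral_mono fun w => ?_
  have hsq : ∀ x : ℝ, ENNReal.ofReal (Real.exp x) ^ 2 = ENNReal.ofReal (Real.exp (2 * x)) := by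
    intro x
    rw [← ENNReal.ofReal_pow (Real.exp_pos _).le, ← Real.exp_nat_mul]
    norm_num
  simp only [hsh b hb1 w, hsh (-b) hb2 w, mul_pow, hsq]
  rw [mul_comm]
  rcases le_total 0 w with hw | hw
  · rw [abs_of_nonneg hw]
    refine le_trans (le_of_eq ?_) le_add_self
    congr 3
    ring
  · rw [abs_of_nonpos hw]
    refine le_trans (le_of_eq ?_) le_self_add
    congr 3
    ring

theorem tendsto_toLp_of_dominated {h : ℝ → ℂ} {u : ℕ → ℝ → ℂ} (h2 : MemLp h 2)
    (hu : ∀ n, MemLp (u n) 2) (hle : ∀ n t, ‖u n t‖ ≤ ‖h t‖)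
    (hlim : ∀ t, Tendsto (fun n => u n t) atTop (𝓝 (h t))) :
    Tendsto (fun n => (hu n).toLp (u n)) atTop (𝓝 (h2.toLp h)) := by
  rw [Lp.tendsto_Lp_iff_tendsto_eLpNorm'']
  have hsq : Tendsto (fun n => eLpNorm (u n - h) 2 volume ^ 2) atTop (𝓝 0) := by
    simp_rw [← lintegral_enorm_sq_eq]
    have hfin : ∫⁻ t, (2 * ‖h t‖ₑ) ^ 2 ≠ ⊤ := by
      simp_rw [mul_pow]
      rw [lintegral_const_mul' _ _ (by norm_num), lintegral_enorm_sq_eq]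
      exact ENNReal.mul_ne_top (by norm_num) (ENNReal.pow_ne_top h2.2.ne)
    have := tendsto_lintegral_of_dominated_convergence' (μ := volume)
      (F := fun n t => ‖(u n - h) t‖ₑ ^ 2) (f := fun _ => 0)
      (fun t => (2 * ‖h t‖ₑ) ^ 2)
      (fun n => ((hu n).1.sub h2.1).enorm.pow_const 2)
      (fun n => Eventually.of_forall fun t => by
        dsimp only
        gcongr
        refine (enorm_sub_le).trans ?_
        rw [two_mul]
        gcongr
        rw [← ofReal_norm, ← ofReal_norm]
        exact ENNReal.ofReal_le_ofReal (hle n t)) hfin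
      (Eventually.of_forall fun t => by
        have h1 : Tendsto (fun n => (u n - h) t) atTop (𝓝 0) := by
          simpa using (hlim t).sub_const (h t)
        have h3 := ((continuous_enorm (E := ℂ)).tendsto _).comp h1
        simpa [Function.comp_def] using ((ENNReal.continuous_pow 2).tendsto _).comp h3)
    simpa using this
  have := ((ENNReal.continuous_rpow_const (y := (1 / 2 : ℝ))).tendsto 0).comp hsq
  rw [ENNReal.zero_rpow_of_pos (by norm_num)] at this
  refine this.congr fun n => ?_
  simp only [Function.comp]
  rw [← ENNReal.rpow_natCast, ← ENNReal.rpow_mul]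
  norm_num

theorem ofReal_exp_sq (x : ℝ) :
    ENNReal.ofReal (Real.exp x) ^ 2 = ENNReal.ofReal (Real.exp (2 * x)) := by
  rw [← ENNReal.ofReal_pow (Real.exp_pos _).le, ← Real.exp_nat_mul]
  norm_num

theorem lintegral_exp_neg_mul_abs_tail {s τ : ℝ} (hs : 0 < s) (hτ : 0 ≤ τ) :
    ∫⁻ v in {v : ℝ | τ < |v|}, ENNReal.ofReal (Real.exp (-(s * |v|))) =
      ENNReal.ofReal (2 / s * Real.exp (-(s * τ))) := by
  have hset : {v : ℝ | τ < |v|} = Ioi τ ∪ Iio (-τ) := by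
    ext v
    simp only [mem_ofPred_eq, lt_abs, mem_union, mem_Ioi, mem_Iio]
    rw [lt_neg]
  have hr : ∫⁻ v in Ioi τ, ENNReal.ofReal (Real.exp (-(s * |v|))) =
      ENNReal.ofReal (Real.exp (-(s * τ)) / s) := by
    have h1 : ∫⁻ v in Ioi τ, ENNReal.ofReal (Real.exp (-(s * |v|))) =
        ∫⁻ v in Ioi τ, ENNReal.ofReal (Real.exp (-s * v)) :=
      setLIntegral_congr_fun measurableSet_Ioi fun v hv => by
        rw [abs_of_nonneg (hτ.trans (le_of_lt hv)), neg_mul]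
    rw [h1, ← ofReal_integral_eq_lintegral_ofReal (integrableOn_exp_mul_Ioi (by linarith) τ)
      (Eventually.of_forall fun _ => (Real.exp_pos _).le), integral_exp_mul_Ioi (by linarith) τ]
    congr 1
    rw [neg_mul, neg_div_neg_eq]
  have hl : ∫⁻ v in Iio (-τ), ENNReal.ofReal (Real.exp (-(s * |v|))) =
      ∫⁻ v in Ioi τ, ENNReal.ofReal (Real.exp (-(s * |v|))) := by
    have himg : Neg.neg '' Ioi τ = Iio (-τ) := by simp
    rw [← himg, lintegral_image_eq_lintegral_abs_deriv_mul measurableSet_Ioi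
      (fun x _ => (hasDerivAt_neg x).hasDerivWithinAt) neg_injective.injOn]
    simp
  rw [hset, lintegral_union measurableSet_Iio, hl, hr, ← ENNReal.ofReal_add (by positivity)
    (by positivity)]
  · congr 1
    ring
  · refine Set.disjoint_left.2 fun v h1 h2 => ?_
    have h1' : τ < v := h1
    have h2' : v < -τ := h2
    linarith

theorem lintegral_exp_neg_mul_abs {s : ℝ} (hs : 0 < s) :
    ∫⁻ v, ENNReal.ofReal (Real.exp (-(s * |v|))) = ENNReal.ofReal (2 / s) := by
  have h := lintegral_exp_neg_mul_abs_tail hs le_rfl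
  rw [mul_zero, neg_zero, Real.exp_zero, mul_one] at h
  rw [← h, show {v : ℝ | 0 < |v|} = {0}ᶜ by ext; simp, restrict_compl_singleton]

/-- A crude form of Young's inequality, needed only to show finiteness. -/
theorem ENNReal.mul_le_sq_add_sq (x y : ℝ≥0∞) : x * y ≤ x ^ 2 + y ^ 2 := by
  rcases le_total x y with h | h
  · refine le_trans ?_ le_add_self
    rw [sq]
    gcongr
  · refine le_trans ?_ le_self_add
    rw [sq]
    gcongr

/-- Square integrable lines need not be integrable, so the contour shift does not apply to `F`
directly. The factor e^{-εz²} has modulus at most e^{εa² - εt²} on the strip. It restores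
integrability and costs e^{2εa²} in squared norms, which disappears as ε → 0. -/
theorem lintegral_fourier_gaussian_regularization_le {F : ℂ → ℂ} {a b ε : ℝ} {M : ℝ≥0∞}
    (hb : b ∈ Ioo 0 a) (hε : 0 < ε)
    (hF : ∀ z : ℂ, z.im ∈ Ioo (-a) a → DifferentiableAt ℂ F z)
    (hM : M ≠ ⊤) (hFM : ∀ y ∈ Ioo (-a) a, ∫⁻ t : ℝ, ‖F (t + y * Complex.I)‖ₑ ^ 2 ≤ M) :
    Integrable (fun t : ℝ => Complex.exp (-ε * t ^ 2) * F t) ∧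
    ∫⁻ w, ‖𝓕 (fun t : ℝ => Complex.exp (-ε * t ^ 2) * F t) w‖ₑ ^ 2 *
        ENNReal.ofReal (Real.exp (4 * Real.pi * b * |w|)) ≤
      ENNReal.ofReal (Real.exp (2 * (ε * a ^ 2))) * ((∫⁻ t : ℝ, ‖F (t + b * Complex.I)‖ₑ ^ 2) +
        ∫⁻ t : ℝ, ‖F (t + (-b : ℝ) * Complex.I)‖ₑ ^ 2) := by
  set G : ℂ → ℂ := fun z => Complex.exp (-ε * z ^ 2) * F z with hGdef
  have hb1 : b ∈ Ioo (-a) a := ⟨by linarith [hb.1, hb.2], hb.2⟩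
  have hb2 : -b ∈ Ioo (-a) a := ⟨by linarith [hb.2], by linarith [hb.1, hb.2]⟩
  have hb0 : (0 : ℝ) ∈ Ioo (-a) a := ⟨by linarith [hb.1, hb.2], by linarith [hb.1, hb.2]⟩
  have hG : ∀ z : ℂ, z.im ∈ Ioo (-a) a → DifferentiableAt ℂ G z := fun z hz =>
    DifferentiableAt.mul (by fun_prop) (hF z hz)
  have hgauss : ∀ t y : ℝ, ‖Complex.exp (-ε * (t + y * Complex.I) ^ 2)‖ₑ =
      ENNReal.ofReal (Real.exp (-ε * (t ^ 2 - y ^ 2))) := by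
    intro t y
    rw [← ofReal_norm, Complex.norm_exp]
    congr 2
    have : (-ε * (t + y * Complex.I) ^ 2 : ℂ) =
        ((-ε * (t ^ 2 - y ^ 2) : ℝ) : ℂ) + ((-2 * ε * t * y : ℝ) : ℂ) * Complex.I := by
      push_cast
      linear_combination (-ε * y ^ 2 : ℂ) * Complex.I_sq
    rw [this, Complex.add_re, Complex.ofReal_re, Complex.re_ofReal_mul, Complex.I_re, mul_zero,
      add_zero]
  have hysq : ∀ y ∈ Ioo (-a) a, y ^ 2 ≤ a ^ 2 := fun y hy => sq_le_sq' hy.1.le hy.2.le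
  have hgle : ∀ y ∈ Ioo (-a) a, ∀ t : ℝ, ‖Complex.exp (-ε * (t + y * Complex.I) ^ 2)‖ₑ ≤
      ENNReal.ofReal (Real.exp (ε * a ^ 2 - ε * t ^ 2)) := by
    intro y hy t
    rw [hgauss]
    refine ENNReal.ofReal_le_ofReal (Real.exp_le_exp.2 ?_)
    have := mul_le_mul_of_nonneg_left (hysq y hy) hε.le
    linarith
  have hGsq : ∀ y ∈ Ioo (-a) a, ∫⁻ t : ℝ, ‖G (t + y * Complex.I)‖ₑ ^ 2 ≤
      ENNReal.ofReal (Real.exp (2 * (ε * a ^ 2))) * ∫⁻ t : ℝ, ‖F (t + y * Complex.I)‖ₑ ^ 2 := by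
    intro y hy
    rw [← lintegral_const_mul' _ _ ENNReal.ofReal_ne_top]
    refine lintegral_mono fun t => ?_
    simp only [hGdef]
    rw [enorm_mul, mul_pow, ← ofReal_exp_sq]
    gcongr
    refine (hgle y hy t).trans (ENNReal.ofReal_le_ofReal (Real.exp_le_exp.2 ?_))
    nlinarith [sq_nonneg t]
  have hgi : Integrable fun t : ℝ => Real.exp (2 * (ε * a ^ 2 - ε * t ^ 2)) := by
    have := (integrable_exp_neg_mul_sq (b := 2 * ε) (by positivity)).const_mul
      (Real.exp (2 * (ε * a ^ 2)))
    refine this.congr (Eventually.of_forall fun t => ?_)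
    simp only
    rw [← Real.exp_add]
    congr 1
    ring
  set B : ℝ≥0∞ := (∫⁻ t : ℝ, ENNReal.ofReal (Real.exp (2 * (ε * a ^ 2 - ε * t ^ 2)))) + M with hB
  have hBt : B ≠ ⊤ := by
    refine ENNReal.add_ne_top.2 ⟨?_, hM⟩
    rw [← ofReal_integral_eq_lintegral_ofReal hgi
      (Eventually.of_forall fun t => (Real.exp_pos _).le)]
    exact ENNReal.ofReal_ne_top
  have hGB : ∀ y ∈ Ioo (-a) a, ∫⁻ t : ℝ, ‖G (t + y * Complex.I)‖ₑ ≤ B := by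
    intro y hy
    calc ∫⁻ t : ℝ, ‖G (t + y * Complex.I)‖ₑ
        ≤ ∫⁻ t : ℝ, (ENNReal.ofReal (Real.exp (2 * (ε * a ^ 2 - ε * t ^ 2))) +
            ‖F (t + y * Complex.I)‖ₑ ^ 2) := by
          refine lintegral_mono fun t => ?_
          simp only [hGdef]
          rw [enorm_mul, ← ofReal_exp_sq]
          refine (mul_le_mul' (hgle y hy t) le_rfl).trans (ENNReal.mul_le_sq_add_sq _ _)
      _ ≤ B := by
          rw [lintegral_add_left (by fun_prop)]
          exact add_le_add le_rfl (hFM y hy)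
  have hG2 : ∀ y ∈ Ioo (-a) a, MemLp (fun t : ℝ => G (t + y * Complex.I)) 2 := by
    intro y hy
    refine ⟨(continuous_horizontal hy hG).aestronglyMeasurable, ?_⟩
    have : eLpNorm (fun t : ℝ => G (t + y * Complex.I)) 2 volume ^ 2 < ⊤ := by
      rw [← lintegral_enorm_sq_eq]
      exact (hGsq y hy).trans_lt
        (ENNReal.mul_lt_top ENNReal.ofReal_lt_top ((hFM y hy).trans_lt hM.lt_top))
    simpa using this
  refine ⟨⟨?_, ?_⟩, ?_⟩
  · simpa [hGdef] using (continuous_horizontal hb0 hG).aestronglyMeasurable (μ := volume)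
  · have := (hGB 0 hb0).trans_lt hBt.lt_top
    simpa [hGdef, HasFiniteIntegral] using this
  · refine (lintegral_fourier_sq_mul_exp_le hb hG hBt hGB hG2).trans ?_
    rw [mul_add]
    exact add_le_add (hGsq b hb1) (hGsq (-b) hb2)

/-- The Paley–Wiener theorem for the Hardy space `H²` of a strip: the Fourier transform on the
real line is square integrable with exponential weight, and the inversion formula holds. -/
theorem exists_fourierInv_eq_of_strip {F : ℂ → ℂ} {a : ℝ} {K : ℝ≥0∞} (ha : 0 < a) (hK : K ≠ ⊤)
    (hF : ∀ z : ℂ, z.im ∈ Ioo (-a) a → DifferentiableAt ℂ F z)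
    (h0 : MemLp (fun t : ℝ => F t) 2)
    (hb : ∀ b ∈ Ioo 0 a, (∫⁻ t : ℝ, ‖F (t + b * Complex.I)‖ₑ ^ 2) +
        ∫⁻ t : ℝ, ‖F (t + (-b : ℝ) * Complex.I)‖ₑ ^ 2 ≤ K) :
    ∃ m : ℝ → ℂ, Integrable m ∧ 𝓕⁻ m = (fun t : ℝ => F t) ∧
      ∫⁻ w, ‖m w‖ₑ ^ 2 * ENNReal.ofReal (Real.exp (4 * Real.pi * a * |w|)) ≤ K := by
  set M : ℝ≥0∞ := K + ∫⁻ t : ℝ, ‖F t‖ₑ ^ 2 with hMdef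
  have hM : M ≠ ⊤ := by
    refine ENNReal.add_ne_top.2 ⟨hK, ?_⟩
    rw [lintegral_enorm_sq_eq]
    exact ENNReal.pow_ne_top h0.2.ne
  have hFM : ∀ y ∈ Ioo (-a) a, ∫⁻ t : ℝ, ‖F (t + y * Complex.I)‖ₑ ^ 2 ≤ M := by
    intro y hy
    rcases lt_trichotomy y 0 with h | h | h
    · have := hb (-y) ⟨by linarith, by linarith [hy.1]⟩
      rw [neg_neg] at this
      exact le_add_self.trans (this.trans le_self_add)
    · subst h
      simp [hMdef]
    · exact le_self_add.trans ((hb y ⟨h, hy.2⟩).trans le_self_add)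
  set ε : ℕ → ℝ := fun n => 1 / ((n : ℝ) + 1) with hεdef
  have hε : ∀ n, 0 < ε n := fun n => Nat.one_div_pos_of_nat
  have hεlim : Tendsto ε atTop (𝓝 0) := tendsto_one_div_add_atTop_nhds_zero_nat
  set u : ℕ → ℝ → ℂ := fun n t => Complex.exp (-ε n * t ^ 2) * F t with hu
  have hreg : ∀ n, ∀ b ∈ Ioo 0 a, _ := fun n b hb' =>
    lintegral_fourier_gaussian_regularization_le hb' (hε n) hF hM hFM
  have hui : ∀ n, Integrable (u n) := fun n =>
    (hreg n (a / 2) ⟨by linarith, by linarith⟩).1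
  have hule : ∀ n t, ‖u n t‖ ≤ ‖F t‖ := by
    intro n t
    simp only [hu]
    rw [norm_mul, Complex.norm_exp]
    refine mul_le_of_le_one_left (norm_nonneg _) (Real.exp_le_one_iff.2 ?_)
    have : (-ε n * t ^ 2 : ℂ) = ((-ε n * t ^ 2 : ℝ) : ℂ) := by push_cast; ring
    rw [this, Complex.ofReal_re]
    nlinarith [sq_nonneg t, hε n]
  have hu2 : ∀ n, MemLp (u n) 2 := fun n =>
    h0.mono (hui n).1 (Eventually.of_forall (hule n))
  have hulim : ∀ t : ℝ, Tendsto (fun n => u n t) atTop (𝓝 (F t)) := by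
    intro t
    have h1 : Tendsto (fun n => Complex.exp (-ε n * t ^ 2)) atTop (𝓝 1) := by
      have : Continuous fun x : ℝ => Complex.exp (-x * t ^ 2) := by fun_prop
      simpa [Function.comp_def] using (this.tendsto 0).comp hεlim
    simpa [hu] using h1.mul_const (F t)
  have hconv := ((Lp.fourierTransformₗᵢ ℝ ℂ).continuous.tendsto _).comp
    (tendsto_toLp_of_dominated h0 hu2 hule hulim)
  -- The Fourier isometry carries the L² convergence of the regularizations to their transforms. A
  -- subsequence converges almost everywhere, as Fatou's lemma requires.
  obtain ⟨ns, hns, hae⟩ := (tendstoInMeasure_of_tendsto_Lp hconv).exists_seq_tendsto_ae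
  set m : ℝ → ℂ := ((𝓕 (h0.toLp _) : Lp ℂ 2 (volume : Measure ℝ)) : ℝ → ℂ) with hm
  have hm2 : MemLp m 2 := Lp.memLp _
  have hae' : ∀ᵐ w, Tendsto (fun i => 𝓕 (u (ns i)) w) atTop (𝓝 (m w)) := by
    have hall : ∀ᵐ w, ∀ i,
        ((𝓕 ((hu2 i).toLp (u i)) : Lp ℂ 2 (volume : Measure ℝ)) : ℝ → ℂ) w = 𝓕 (u i) w :=
      ae_all_iff.2 fun i => coeFn_fourier_toLp_ae_eq (hui i) (hu2 i)
    filter_upwards [hae, hall] with w h1 h2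
    refine h1.congr fun i => ?_
    exact h2 (ns i)
  have hbound : ∀ b ∈ Ioo 0 a,
      ∫⁻ w, ‖m w‖ₑ ^ 2 * ENNReal.ofReal (Real.exp (4 * Real.pi * b * |w|)) ≤ K := by
    intro b hb'
    refine lintegral_le_of_tendsto_ae
      (u := fun i w => ‖𝓕 (u (ns i)) w‖ₑ ^ 2 *
        ENNReal.ofReal (Real.exp (4 * Real.pi * b * |w|)))
      (C := fun i => ENNReal.ofReal (Real.exp (2 * (ε (ns i) * a ^ 2))) * K) (fun i => ?_) ?_
      (fun i => ?_) ?_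
    · have := (continuous_fourier_of_integrable (hui (ns i))).enorm.measurable
      exact (Measurable.mul (this.pow_const 2) (by fun_prop)).aemeasurable
    · filter_upwards [hae'] with w hw
      have h1 := ((continuous_enorm (E := ℂ)).tendsto _).comp hw
      have h2 := ((ENNReal.continuous_pow 2).tendsto _).comp h1
      exact ENNReal.Tendsto.mul_const h2 (Or.inr ENNReal.ofReal_ne_top)
    · exact (hreg (ns i) b hb').2.trans (mul_le_mul' le_rfl (hb b hb'))
    · have hc : Continuous fun x : ℝ => ENNReal.ofReal (Real.exp (2 * (x * a ^ 2))) :=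
        ENNReal.continuous_ofReal.comp (by fun_prop)
      have h1 := (hc.tendsto 0).comp (hεlim.comp hns.tendsto_atTop)
      have h2 := ENNReal.Tendsto.mul_const h1 (b := K) (Or.inr hK)
      simpa [Function.comp_def] using h2
  have hbound_a : ∫⁻ w, ‖m w‖ₑ ^ 2 * ENNReal.ofReal (Real.exp (4 * Real.pi * a * |w|)) ≤ K := by
    -- The bound is known only for b < a; Fatou along heights increasing to a gives the endpoint
    -- weight.
    set b : ℕ → ℝ := fun n => a - a * (1 / ((n : ℝ) + 2)) with hbdef
    have hbmem : ∀ n, b n ∈ Ioo 0 a := by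
      intro n
      have h1 : 0 < 1 / ((n : ℝ) + 2) := by positivity
      have h2 : 1 / ((n : ℝ) + 2) < 1 := by
        rw [div_lt_one (by positivity)]
        linarith [(Nat.cast_nonneg n : (0 : ℝ) ≤ n)]
      constructor <;> simp only [hbdef] <;> nlinarith
    have hblim : Tendsto b atTop (𝓝 a) := by
      have h1 : Tendsto (fun n : ℕ => 1 / ((n : ℝ) + 2)) atTop (𝓝 0) := by
        refine (hεlim.comp (tendsto_add_atTop_nat 1)).congr fun n => ?_
        simp only [Function.comp, hεdef]
        push_cast
        ring
      simpa [hbdef] using (h1.const_mul a).const_sub a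
    refine lintegral_le_of_tendsto_ae (C := fun _ => K)
      (u := fun n w => ‖m w‖ₑ ^ 2 * ENNReal.ofReal (Real.exp (4 * Real.pi * b n * |w|)))
      (fun n => ?_) (Eventually.of_forall fun w => ?_) (fun n => hbound _ (hbmem n))
      tendsto_const_nhds
    · exact (hm2.1.enorm.pow_const 2).mul (Measurable.aemeasurable (by fun_prop))
    · have hc : Continuous fun x : ℝ =>
          ENNReal.ofReal (Real.exp (4 * Real.pi * x * |w|)) :=
        ENNReal.continuous_ofReal.comp (by fun_prop)
      exact ENNReal.Tendsto.const_mul ((hc.tendsto a).comp hblim)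
        (Or.inr (ENNReal.pow_ne_top enorm_ne_top))
  have hmi : Integrable m := by
    refine ⟨hm2.1, ?_⟩
    -- Here |m| is split as (|m| e^{2πa|w|}) · e^{-2πa|w|}, a product of two square integrable
    -- factors.
    calc ∫⁻ w, ‖m w‖ₑ
        ≤ ∫⁻ w, (‖m w‖ₑ ^ 2 * ENNReal.ofReal (Real.exp (4 * Real.pi * a * |w|)) +
            ENNReal.ofReal (Real.exp (-(4 * Real.pi * a * |w|)))) := by
          refine lintegral_mono fun w => ?_
          have h1 : ENNReal.ofReal (Real.exp (4 * Real.pi * a * |w|)) =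
              ENNReal.ofReal (Real.exp (2 * Real.pi * a * |w|)) ^ 2 := by
            rw [ofReal_exp_sq]; congr 2; ring
          have h2 : ENNReal.ofReal (Real.exp (-(4 * Real.pi * a * |w|))) =
              ENNReal.ofReal (Real.exp (-(2 * Real.pi * a * |w|))) ^ 2 := by
            rw [ofReal_exp_sq]; congr 2; ring
          rw [h1, h2, ← mul_pow]
          refine le_trans (le_of_eq ?_) (ENNReal.mul_le_sq_add_sq _ _)
          rw [mul_assoc, ← ENNReal.ofReal_mul (Real.exp_pos _).le, ← Real.exp_add]
          simp
      _ < ⊤ := by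
          rw [lintegral_add_right _ (by fun_prop)]
          refine ENNReal.add_lt_top.2 ⟨hbound_a.trans_lt hK.lt_top, ?_⟩
          rw [lintegral_exp_neg_mul_abs (by positivity)]
          exact ENNReal.ofReal_lt_top
  refine ⟨m, hmi, ?_, hbound_a⟩
  refine fourierInv_eq_of_fourier_toLp_ae_eq ?_ h0 hmi (Filter.EventuallyEq.refl _ _)
  simpa using continuous_horizontal (y := 0) ⟨by linarith, ha⟩ hF

/-! ### Norms of exponentially decaying tails -/

/-- The integral of e^{-aq|v|} over |v| > τ is (2/(aq)) e^{-aqτ}; the constant is its q-th root. -/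
theorem eLpNorm_le_of_exp_tail {h : ℝ → ℂ} {A a τ q : ℝ} (hA : 0 ≤ A) (ha : 0 < a) (hτ : 0 ≤ τ)
    (hq : 0 < q)
    (hh : ∀ᵐ v, ‖h v‖ ≤ {v : ℝ | τ < |v|}.indicator (fun v => A * Real.exp (-(a * |v|))) v) :
    eLpNorm h (ENNReal.ofReal q) volume ≤
      ENNReal.ofReal (A * (2 / (a * q)) ^ (1 / q) * Real.exp (-(a * τ))) := by
  have hS : MeasurableSet {v : ℝ | τ < |v|} := measurableSet_lt measurable_const (by fun_prop)
  have hq0 : ENNReal.ofReal q ≠ 0 := by simpa using hq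
  rw [eLpNorm_eq_lintegral_rpow_enorm_toReal hq0 ENNReal.ofReal_ne_top, ENNReal.toReal_ofReal hq.le]
  have h1 : ∫⁻ v, ‖h v‖ₑ ^ q ≤
      ENNReal.ofReal (A ^ q * (2 / (a * q) * Real.exp (-(a * q * τ)))) := by
    rw [ENNReal.ofReal_mul (by positivity), ← lintegral_exp_neg_mul_abs_tail (by positivity) hτ,
      ← lintegral_const_mul' _ _ ENNReal.ofReal_ne_top, ← lintegral_indicator hS]
    refine lintegral_mono_ae ?_
    filter_upwards [hh] with v hv
    by_cases hmem : v ∈ {v : ℝ | τ < |v|}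
    · rw [indicator_of_mem hmem] at hv ⊢
      rw [← ofReal_norm, ENNReal.ofReal_rpow_of_nonneg (norm_nonneg _) hq.le,
        ← ENNReal.ofReal_mul (by positivity)]
      refine ENNReal.ofReal_le_ofReal ((Real.rpow_le_rpow (norm_nonneg _) hv hq.le).trans
        (le_of_eq ?_))
      rw [Real.mul_rpow hA (Real.exp_pos _).le, ← Real.exp_mul]
      congr 2
      ring
    · rw [indicator_of_notMem hmem] at hv ⊢
      have : h v = 0 := norm_le_zero_iff.1 hv
      simp [this, hq]
  refine (ENNReal.rpow_le_rpow h1 (by positivity)).trans (le_of_eq ?_)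
  rw [ENNReal.ofReal_rpow_of_nonneg (by positivity) (by positivity)]
  congr 1
  rw [Real.mul_rpow (by positivity) (by positivity), Real.mul_rpow (by positivity) (by positivity),
    ← Real.rpow_mul hA, ← Real.exp_mul, mul_one_div_cancel hq.ne', Real.rpow_one, ← mul_assoc]
  congr 2
  field_simp

theorem eLpNorm_top_le_of_exp_tail {h : ℝ → ℂ} {A a τ : ℝ} (hA : 0 ≤ A) (ha : 0 < a)
    (hh : ∀ᵐ v, ‖h v‖ ≤ {v : ℝ | τ < |v|}.indicator (fun v => A * Real.exp (-(a * |v|))) v) :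
    eLpNorm h ⊤ volume ≤ ENNReal.ofReal (A * Real.exp (-(a * τ))) := by
  rw [eLpNorm_exponent_top]
  refine eLpNormEssSup_le_of_ae_bound ?_
  filter_upwards [hh] with v hv
  refine hv.trans ?_
  by_cases hmem : v ∈ {v : ℝ | τ < |v|}
  · rw [indicator_of_mem hmem]
    have : τ < |v| := hmem
    gcongr
  · rw [indicator_of_notMem hmem]
    positivity

theorem eLpNorm_le_of_weighted_sq_tail {h W : ℝ → ℂ} {a τ q : ℝ} {A : ℝ} (hA : 0 ≤ A) (ha : 0 < a)
    (hτ : 0 ≤ τ) (hq1 : 1 ≤ q) (hq2 : q < 2) (hWm : AEStronglyMeasurable W volume)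
    (hW : eLpNorm W 2 volume ≤ ENNReal.ofReal A)
    (hh : ∀ᵐ v, h v =
      W v * {v : ℝ | τ < |v|}.indicator (fun v => (Real.exp (-(a * |v|)) : ℂ)) v) :
    eLpNorm h (ENNReal.ofReal q) volume ≤
      ENNReal.ofReal (A * ((2 - q) / (q * a)) ^ (1 / q - 1 / 2) * Real.exp (-(a * τ))) := by
  have hS : MeasurableSet {v : ℝ | τ < |v|} := measurableSet_lt measurable_const (by fun_prop)
  have hq0 : 0 < q := by linarith
  have h2q : 0 < 2 - q := by linarith
  -- The Hölder exponent with 1/q = 1/2 + 1/s. It gives 1/s = 1/q - 1/2 and 2/(as) = (2-q)/(qa),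
  -- hence the stated constant.
  set s : ℝ := 2 * q / (2 - q) with hs
  have hs0 : 0 < s := by positivity
  set E : ℝ → ℂ := {v : ℝ | τ < |v|}.indicator (fun v => (Real.exp (-(a * |v|)) : ℂ)) with hE
  have hEm : AEStronglyMeasurable E volume := by
    refine AEStronglyMeasurable.indicator ?_ hS
    exact Continuous.aestronglyMeasurable (by fun_prop)
  have hEle := eLpNorm_le_of_exp_tail (h := E) (A := 1) (q := s) zero_le_one ha hτ hs0
    (Eventually.of_forall fun v => by
      by_cases hmem : v ∈ {v : ℝ | τ < |v|}
      · rw [hE, indicator_of_mem hmem, indicator_of_mem hmem, Complex.norm_real, one_mul,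
          Real.norm_of_nonneg (Real.exp_pos _).le]
      · rw [hE, indicator_of_notMem hmem, indicator_of_notMem hmem, norm_zero])
  have : ENNReal.HolderTriple 2 (ENNReal.ofReal s) (ENNReal.ofReal q) := by
    constructor
    rw [← ENNReal.ofReal_inv_of_pos hs0, ← ENNReal.ofReal_inv_of_pos hq0,
      show (2 : ℝ≥0∞) = ENNReal.ofReal 2 by simp, ← ENNReal.ofReal_inv_of_pos two_pos,
      ← ENNReal.ofReal_add (by positivity) (by positivity)]
    congr 1
    rw [hs]
    field_simp
    ring
  have hprod : eLpNorm h (ENNReal.ofReal q) volume ≤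
      eLpNorm W 2 volume * eLpNorm E (ENNReal.ofReal s) volume := by
    rw [eLpNorm_congr_ae (g := W • E) (by filter_upwards [hh] with v hv; rw [hv]; rfl)]
    exact eLpNorm_smul_le_mul_eLpNorm hEm hWm
  refine hprod.trans ((mul_le_mul' hW hEle).trans (le_of_eq ?_))
  rw [← ENNReal.ofReal_mul hA, one_mul, mul_assoc]
  congr 3
  congr 1
  · rw [hs]
    field_simp
  · rw [hs]
    field_simp

/-! ### Mellin synthesis of Bernstein functions -/

/-- The function on the half-plane with Mellin representation `ψ`, continued in `θ`. -/
noncomputable def mellinExtension (c : ℝ) (ψ : ℝ → ℂ) (z : ℂ) : ℂ :=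
  1 / (2 * (Real.pi : ℂ)) * ∫ v : ℝ, ψ v * Complex.exp ((-(c : ℂ) - (v : ℂ) * Complex.I) * z)

theorem mellin_repr_eq (c : ℝ) (ψ : ℝ → ℂ) {x : ℝ} (hx : 0 < x) :
    1 / (2 * (Real.pi : ℂ)) * ∫ v : ℝ, ψ v * (x : ℂ) ^ (-(c : ℂ) - (v : ℂ) * Complex.I) =
      mellinExtension c ψ (Real.log x) := by
  rw [mellinExtension]
  congr 2
  ext v
  rw [Complex.cpow_def_of_ne_zero (by exact_mod_cast hx.ne'), ← Complex.ofReal_log hx.le, mul_comm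
    (Complex.ofReal _)]

/-- The substitution v = -2πw matches the kernel e^{-ivt} dv/2π with e^{2πiwt} dw. This is why `m`
is evaluated at -v/2π throughout. -/
theorem exp_mul_mellinExtension (c : ℝ) (m : ℝ → ℂ) (t : ℝ) :
    Complex.exp (c * t) * mellinExtension c (fun v => m (-(2 * Real.pi)⁻¹ * v)) t = 𝓕⁻ m t := by
  have hsub := Measure.integral_comp_mul_left
    (fun w : ℝ => m w * Complex.exp (2 * Real.pi * w * t * Complex.I)) (-(2 * Real.pi)⁻¹)
  rw [mellinExtension, Real.fourierInv_eq', mul_left_comm, ← integral_const_mul]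
  have hpi := Real.pi_pos
  have e1 : ∀ v : ℝ, Complex.exp (c * t) * (m (-(2 * Real.pi)⁻¹ * v) *
      Complex.exp ((-(c : ℂ) - (v : ℂ) * Complex.I) * t)) = m (-(2 * Real.pi)⁻¹ * v) *
        Complex.exp (2 * Real.pi * (-(2 * Real.pi)⁻¹ * v : ℝ) * t * Complex.I) := by
    intro v
    rw [mul_left_comm, ← Complex.exp_add]
    congr 2
    have : (Real.pi : ℂ) ≠ 0 := by exact_mod_cast hpi.ne'
    push_cast
    field_simp
    ring
  simp_rw [e1]
  rw [hsub, abs_inv, abs_neg, abs_of_pos (by positivity), inv_inv, Complex.real_smul, ← mul_assoc]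
  have : (1 / (2 * (Real.pi : ℂ))) * ((2 * Real.pi : ℝ) : ℂ) = 1 := by
    push_cast
    have : (Real.pi : ℂ) ≠ 0 := by exact_mod_cast hpi.ne'
    field_simp
  rw [this, one_mul]
  refine integral_congr_ae (Eventually.of_forall fun w => ?_)
  simp only [smul_eq_mul, RCLike.inner_apply, conj_trivial]
  rw [mul_comm]
  congr 2
  push_cast
  ring

/-- Bounded support keeps |-c - iv| ≤ |c| + σ, which supplies a local dominating function for
differentiation under the integral. -/
theorem differentiable_mellinExtension (c : ℝ) {ψ : ℝ → ℂ} {σ : ℝ} (hσ : 0 ≤ σ)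
    (hψ : Integrable ψ) (hsupp : ∀ v, σ < |v| → ψ v = 0) :
    Differentiable ℂ (mellinExtension c ψ) := by
  intro z₀
  refine DifferentiableAt.const_mul ?_ _
  have hexp : ∀ v : ℝ, |v| ≤ σ → ‖-(c : ℂ) - (v : ℂ) * Complex.I‖ ≤ |c| + σ := by
    intro v hv
    refine (norm_sub_le _ _).trans (add_le_add ?_ ?_)
    · simp
    · simpa using hv
  have hmeas : ∀ z : ℂ, AEStronglyMeasurable
      (fun v : ℝ => ψ v * Complex.exp ((-(c : ℂ) - (v : ℂ) * Complex.I) * z)) volume := fun z =>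
    hψ.1.mul (Continuous.aestronglyMeasurable (by fun_prop))
  have hbound : ∀ z : ℂ, ∀ v : ℝ,
      ‖ψ v * Complex.exp ((-(c : ℂ) - (v : ℂ) * Complex.I) * z)‖ ≤
        ‖ψ v‖ * Real.exp ((|c| + σ) * ‖z‖) := by
    intro z v
    rcases le_or_gt |v| σ with hv | hv
    · rw [norm_mul]
      gcongr
      refine (Complex.norm_exp_le_exp_norm _).trans (Real.exp_le_exp.2 ?_)
      rw [norm_mul]
      gcongr
      exact hexp v hv
    · simp [hsupp v hv]
  refine (hasDerivAt_integral_of_dominated_loc_of_deriv_le (Metric.ball_mem_nhds z₀ one_pos)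
    (F' := fun z v => ψ v * Complex.exp ((-(c : ℂ) - (v : ℂ) * Complex.I) * z) *
      (-(c : ℂ) - (v : ℂ) * Complex.I))
    (bound := fun v => ‖ψ v‖ * Real.exp ((|c| + σ) * (‖z₀‖ + 1)) * (|c| + σ))
    (Eventually.of_forall hmeas) ?_ ?_ ?_ ?_ ?_).2.differentiableAt
  · exact (hψ.norm.mul_const _).mono' (hmeas z₀) (Eventually.of_forall (hbound z₀))
  · exact (hmeas z₀).mul (Continuous.aestronglyMeasurable (by fun_prop))
  · refine Eventually.of_forall fun v z hz => ?_
    rcases le_or_gt |v| σ with hv | hv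
    · rw [norm_mul]
      refine mul_le_mul ((hbound z v).trans ?_) (hexp v hv) (norm_nonneg _) (by positivity)
      have hz' : ‖z‖ ≤ ‖z₀‖ + 1 := by
        have h1 : ‖z - z₀‖ < 1 := by simpa [dist_eq_norm] using hz
        have h2 := norm_sub_norm_le z z₀
        linarith
      gcongr
    · simp only [hsupp v hv, zero_mul, norm_zero, le_refl]
  · exact (hψ.norm.mul_const _).mul_const _
  · refine Eventually.of_forall fun v z _ => ?_
    have h1 : HasDerivAt (fun z : ℂ => (-(c : ℂ) - (v : ℂ) * Complex.I) * z)
        (-(c : ℂ) - (v : ℂ) * Complex.I) z := by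
      simpa using (hasDerivAt_id z).const_mul (-(c : ℂ) - (v : ℂ) * Complex.I)
    have h2 := (h1.cexp).const_mul (ψ v)
    rwa [← mul_assoc] at h2

theorem memMellinBernstein_mellinExtension {p c σ : ℝ} (hp : 1 ≤ p) (hσ : 0 ≤ σ) {m : ℝ → ℂ}
    (hm : Integrable m) (hsupp : ∀ w, σ / (2 * Real.pi) < |w| → m w = 0)
    (hmem : MemLp (𝓕⁻ m) (ENNReal.ofReal p)) :
    MemMellinBernstein p c σ (fun x => mellinExtension c (fun v => m (-(2 * Real.pi)⁻¹ * v))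
      (Real.log x.1 + x.2 * Complex.I)) := by
  have hpi := Real.pi_pos
  set ψ : ℝ → ℂ := fun v => m (-(2 * Real.pi)⁻¹ * v) with hψdef
  have hψ : Integrable ψ := hm.comp_mul_left' (by simp [hpi.ne'])
  have hψs : ∀ v, σ < |v| → ψ v = 0 := by
    intro v hv
    refine hsupp _ ?_
    rw [abs_mul, abs_neg, abs_of_pos (by positivity), div_eq_inv_mul]
    gcongr
  have hd := differentiable_mellinExtension c hσ hψ hψs
  refine ⟨polarAnalyticOn_of_differentiable hd, ⟨?_, ?_⟩, ?_⟩
  · refine aestronglyMeasurable_mellinWeight ?_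
    have : ContinuousOn (fun r : ℝ => (Real.log r : ℂ) + ((0 : ℝ) : ℂ) * Complex.I) (Ioi 0) := by
      refine ContinuousOn.add ?_ continuousOn_const
      exact Complex.continuous_ofReal.comp_continuousOn
        (Real.continuousOn_log.mono fun x hx => (ne_of_gt hx))
    exact hd.continuous.comp_continuousOn this
  · have h1 := mellinXNorm_eq_eLpNorm hp c (fun r => mellinExtension c ψ
      (Real.log r + (0 : ℝ) * Complex.I))
    rw [mellinXNorm] at h1
    rw [h1]
    have h2 : (fun t : ℝ => Complex.exp (c * t) * mellinExtension c ψ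
        (Real.log (Real.exp t) + (0 : ℝ) * Complex.I)) = 𝓕⁻ m := by
      ext t
      rw [Real.log_exp, Complex.ofReal_zero, zero_mul, add_zero, exp_mul_mellinExtension]
    rw [h2]
    exact hmem.2
  · refine ⟨1 + (2 * Real.pi)⁻¹ * ∫ v, ‖ψ v‖, ?_, ?_⟩
    · have : 0 ≤ ∫ v, ‖ψ v‖ := integral_nonneg fun _ => norm_nonneg _
      positivity
    · intro r θ hr
      have hnorm : ∀ v, ‖ψ v * Complex.exp ((-(c : ℂ) - (v : ℂ) * Complex.I) *
          (Real.log r + θ * Complex.I))‖ ≤ ‖ψ v‖ * (r ^ (-c) * Real.exp (σ * |θ|)) := by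
        intro v
        rcases le_or_gt |v| σ with hv | hv
        · rw [norm_mul, Complex.norm_exp, Real.rpow_def_of_pos hr, ← Real.exp_add]
          gcongr
          have : ((-(c : ℂ) - (v : ℂ) * Complex.I) * (Real.log r + θ * Complex.I)).re =
              Real.log r * -c + v * θ := by
            simp
            ring
          rw [this]
          refine add_le_add le_rfl ?_
          calc v * θ ≤ |v * θ| := le_abs_self _
            _ = |v| * |θ| := abs_mul _ _
            _ ≤ σ * |θ| := by gcongr
        · simp [hψs v hv]
      have hI : ‖∫ v, ψ v * Complex.exp ((-(c : ℂ) - (v : ℂ) * Complex.I) *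
          (Real.log r + θ * Complex.I))‖ ≤
            (∫ v, ‖ψ v‖) * (r ^ (-c) * Real.exp (σ * |θ|)) := by
        rw [← integral_mul_const]
        exact norm_integral_le_of_norm_le (hψ.norm.mul_const _) (Eventually.of_forall hnorm)
      simp only [mellinExtension]
      rw [norm_mul]
      have h2pi : ‖1 / (2 * (Real.pi : ℂ))‖ = (2 * Real.pi)⁻¹ := by
        simp [abs_of_pos hpi]
      rw [h2pi]
      have hrp : 0 ≤ r ^ (-c) * Real.exp (σ * |θ|) := by positivity
      refine (mul_le_mul_of_nonneg_left hI (by positivity)).trans ?_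
      rw [mul_assoc (1 + _), add_mul, mul_assoc]
      linarith

/-! ### Mellin representations and frequency truncation -/

theorem integrable_mul_cpow {ψ : ℝ → ℂ} (hψ : Integrable ψ) (c : ℝ) {x : ℝ} (hx : 0 < x) :
    Integrable fun v : ℝ => ψ v * (x : ℂ) ^ (-(c : ℂ) - (v : ℂ) * Complex.I) := by
  have hx' : (x : ℂ) ≠ 0 := by exact_mod_cast hx.ne'
  have hc : Continuous fun v : ℝ => (x : ℂ) ^ (-(c : ℂ) - (v : ℂ) * Complex.I) :=
    Continuous.const_cpow (by fun_prop) (Or.inl hx')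
  refine hψ.mul_bdd (c := x ^ (-c)) hc.aestronglyMeasurable (Eventually.of_forall fun v => ?_)
  rw [Complex.norm_cpow_eq_rpow_re_of_pos hx]
  simp

theorem IsMellinRep.sub {q : ℝ≥0∞} {c : ℝ} {φ₁ φ₂ ψ₁ ψ₂ : ℝ → ℂ} (h₁ : IsMellinRep q c φ₁ ψ₁)
    (h₂ : IsMellinRep q c φ₂ ψ₂) :
    IsMellinRep q c (fun x => φ₁ x - φ₂ x) (fun v => ψ₁ v - ψ₂ v) := by
  refine ⟨h₁.integrable.sub h₂.integrable, h₁.memLp.sub h₂.memLp, fun x hx => ?_⟩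
  simp only [sub_mul]
  rw [integral_sub (integrable_mul_cpow h₁.integrable c hx) (integrable_mul_cpow h₂.integrable c hx),
    mul_sub, ← h₁.repr x hx, ← h₂.repr x hx]

theorem isMellinRep_of_fourierInv {q : ℝ≥0∞} {c : ℝ} {φ m : ℝ → ℂ} (hm : Integrable m)
    (hφ : ∀ t : ℝ, 𝓕⁻ m t = Complex.exp (c * t) * φ (Real.exp t))
    (hq : MemLp (fun v => m (-(2 * Real.pi)⁻¹ * v)) q) :
    IsMellinRep q c φ (fun v => m (-(2 * Real.pi)⁻¹ * v)) := by
  refine ⟨hm.comp_mul_left' (by simp [Real.pi_ne_zero]), hq, fun x hx => ?_⟩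
  rw [mellin_repr_eq c _ hx]
  have := hφ (Real.log x)
  rw [← exp_mul_mellinExtension c m, Real.exp_log hx] at this
  exact (mul_left_cancel₀ (Complex.exp_ne_zero _) this).symm

/-- Truncating the frequency side of `f` by a multiplier `β` bounded by one and supported in
`[-σ, σ]` bounds the distance of `f` to the Bernstein space. -/
theorem mellinDist_le_eLpNorm {q : ℝ≥0∞} {p c σ : ℝ} (hp : 1 ≤ p) (hσ : 0 ≤ σ) {f : ℝ × ℝ → ℂ}
    {m β : ℝ → ℂ} (hrep : IsMellinRep q c (fun x => f (x, 0)) (fun v => m (-(2 * Real.pi)⁻¹ * v)))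
    (hm : Integrable m) (hβm : Measurable β) (hβ1 : ∀ w, ‖β w‖ ≤ 1)
    (hβs : ∀ w, σ / (2 * Real.pi) < |w| → β w = 0)
    (hmem : MemLp (𝓕⁻ (fun w => m w * β w)) (ENNReal.ofReal p)) :
    mellinDist q p c σ f ≤ eLpNorm (fun v => m (-(2 * Real.pi)⁻¹ * v) -
      m (-(2 * Real.pi)⁻¹ * v) * β (-(2 * Real.pi)⁻¹ * v)) q volume := by
  have hmβ : Integrable fun w => m w * β w :=
    hm.mul_bdd (c := 1) hβm.aestronglyMeasurable (Eventually.of_forall hβ1)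
  have hB := memMellinBernstein_mellinExtension (c := c) hp hσ hmβ
    (fun w hw => by simp [hβs w hw]) hmem
  have hψ'q : MemLp (fun v => m (-(2 * Real.pi)⁻¹ * v) * β (-(2 * Real.pi)⁻¹ * v)) q := by
    refine hrep.memLp.mono ?_ (Eventually.of_forall fun v => ?_)
    · exact hrep.memLp.1.mul (hβm.comp (by fun_prop)).aestronglyMeasurable
    · rw [norm_mul]
      exact mul_le_of_le_one_right (norm_nonneg _) (hβ1 _)
  have hrep' := isMellinRep_of_fourierInv (c := c)
    (φ := fun x => mellinExtension c (fun v => m (-(2 * Real.pi)⁻¹ * v) *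
      β (-(2 * Real.pi)⁻¹ * v)) (Real.log x + (0 : ℝ) * Complex.I)) hmβ
    (fun t => by
      rw [Real.log_exp, Complex.ofReal_zero, zero_mul, add_zero,
        ← exp_mul_mellinExtension c (fun w => m w * β w)]) hψ'q
  refine (iInf₂_le _ hB).trans ?_
  exact iInf₂_le _ (hrep.sub hrep')

/-- The product ĥ·s is the transform of the convolution of h with the inverse transform of s. This
convolution is continuous and integrable, so Fourier inversion returns it. Hence smooth frequency
cut-offs preserve L¹. -/
theorem integrable_fourierInv_fourier_mul {h : ℝ → ℂ} (hh : Integrable h) (s : 𝓢(ℝ, ℂ)) :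
    Integrable (𝓕⁻ (fun w => 𝓕 h w * s w)) := by
  set k : 𝓢(ℝ, ℂ) := 𝓕⁻ s with hk
  have hk' : 𝓕 (k : ℝ → ℂ) = s := by
    rw [← SchwartzMap.fourier_coe, hk, FourierTransform.fourier_fourierInv_eq]
  set u : ℝ → ℂ := h ⋆[ContinuousLinearMap.mul ℂ ℂ] (k : ℝ → ℂ) with hu
  have hki : Integrable (k : ℝ → ℂ) := k.integrable
  have hui : Integrable u := hh.integrable_convolution _ hki
  have huc : Continuous u := by
    refine BddAbove.continuous_convolution_right_of_integrable _ ?_ hh k.continuous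
    obtain ⟨C, -, hC⟩ := k.decay 0 0
    refine ⟨C, ?_⟩
    rintro _ ⟨x, rfl⟩
    simpa using hC x
  have hfu : 𝓕 u = fun w => 𝓕 h w * s w := by
    ext w
    rw [hu, Real.fourier_mul_convolution_eq hh hki, hk']
  have hfi : Integrable (𝓕 u) := by
    rw [hfu]
    refine (s.integrable (μ := volume)).bdd_mul (c := ∫ t, ‖h t‖)
      (continuous_fourier_of_integrable hh).aestronglyMeasurable (Eventually.of_forall fun w => ?_)
    exact VectorFourier.norm_fourierIntegral_le_integral_norm _ _ _ _ _
  rw [← hfu, huc.fourierInv_fourier_eq hui hfi]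
  exact hui

/-! ### Hardy spaces and the distance estimates -/

theorem logCoord_ofReal (c : ℝ) (f : ℝ × ℝ → ℂ) (t : ℝ) :
    logCoord c f t = Complex.exp (c * t) * f (Real.exp t, 0) := by
  simp [logCoord]

theorem eLpNorm_logCoord_horizontal {p : ℝ} (hp : 1 ≤ p) (c : ℝ) (f : ℝ × ℝ → ℂ) (y : ℝ) :
    eLpNorm (fun t : ℝ => logCoord c f (t + y * Complex.I)) (ENNReal.ofReal p) volume =
      mellinXNorm p c (fun r => f (r, y)) := by
  rw [mellinXNorm_eq_eLpNorm hp]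
  refine eLpNorm_congr_norm_ae (Eventually.of_forall fun t => ?_)
  simp [logCoord, Complex.norm_exp]

theorem MemMellinHardy.mellinXNorm_add_le {p c a : ℝ} (hp : 1 ≤ p) {f : ℝ × ℝ → ℂ}
    (hf : MemMellinHardy p c a f) {b : ℝ} (hb : b ∈ Ioo 0 a) :
    mellinXNorm p c (fun r => f (r, b)) ^ p + mellinXNorm p c (fun r => f (r, -b)) ^ p ≤
      2 * ENNReal.ofReal (mellinHardyNorm p c a f) ^ p := by
  have hp0 : 0 < p := by linarith
  rw [mellinHardyNorm, ENNReal.ofReal_toReal hf.norm_lt_top.ne]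
  have h : ((mellinXNorm p c (fun r => f (r, b)) ^ p +
      mellinXNorm p c (fun r => f (r, -b)) ^ p) / 2) ^ (1 / p) ≤ mellinHardyENorm p c a f :=
    le_iSup₂ (f := fun θ (_ : θ ∈ Ioo 0 a) => ((mellinXNorm p c (fun r => f (r, θ)) ^ p +
      mellinXNorm p c (fun r => f (r, -θ)) ^ p) / 2) ^ (1 / p)) b hb
  rw [one_div, ENNReal.rpow_inv_le_iff hp0] at h
  rwa [ENNReal.div_le_iff two_ne_zero ENNReal.ofNat_ne_top, mul_comm] at h

theorem MemMellinHardy.differentiableAt_logCoord {p c a : ℝ} {f : ℝ × ℝ → ℂ}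
    (hf : MemMellinHardy p c a f) (z : ℂ) (hz : z.im ∈ Ioo (-a) a) :
    DifferentiableAt ℂ (logCoord c f) z :=
  _root_.differentiableAt_logCoord hf.polarAnalytic hz.1 hz.2

theorem MemMellinHardy.continuous_logCoord_ofReal {p c a : ℝ} (ha : 0 < a) {f : ℝ × ℝ → ℂ}
    (hf : MemMellinHardy p c a f) : Continuous fun t : ℝ => logCoord c f t := by
  simpa using continuous_horizontal (y := 0) ⟨by linarith, ha⟩ hf.differentiableAt_logCoord

theorem MemMellinHardy.memLp_logCoord_ofReal {p c a : ℝ} (hp : 1 ≤ p) (ha : 0 < a)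
    {f : ℝ × ℝ → ℂ} (hf : MemMellinHardy p c a f) :
    MemLp (fun t : ℝ => logCoord c f t) (ENNReal.ofReal p) := by
  refine ⟨(hf.continuous_logCoord_ofReal ha).aestronglyMeasurable, ?_⟩
  have h := eLpNorm_logCoord_horizontal hp c f 0
  simp only [Complex.ofReal_zero, zero_mul, add_zero] at h
  rw [h]
  exact (hf.memX 0 ⟨by linarith, ha⟩).2

theorem abs_neg_two_pi_inv_mul (v : ℝ) : |-(2 * Real.pi)⁻¹ * v| = (2 * Real.pi)⁻¹ * |v| := by
  rw [abs_mul, abs_neg, abs_of_pos (by positivity)]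

/-- The distance estimate for `p = 1`, for any norm that is controlled on exponential tails. -/
theorem mellinDist_one_le {a c σ K : ℝ} (ha : 0 < a) (hσ : 0 < σ) {f : ℝ × ℝ → ℂ}
    (hf : MemMellinHardy 1 c a f) {q : ℝ≥0∞}
    (hK : ∀ (h : ℝ → ℂ) (τ : ℝ), 0 ≤ τ →
      (∀ᵐ v, ‖h v‖ ≤ {v : ℝ | τ < |v|}.indicator
        (fun v => 2 * mellinHardyNorm 1 c a f * Real.exp (-(a * |v|))) v) →
      eLpNorm h q volume ≤ ENNReal.ofReal (K * Real.exp (-(a * τ)))) :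
    MemMellinG q c (fun x => f (x, 0)) ∧
      mellinDist q 1 c σ f ≤ ENNReal.ofReal (K * Real.exp (-(a * σ))) := by
  have hpi := Real.pi_pos
  set N := mellinHardyNorm 1 c a f with hN
  have hN0 : 0 ≤ N := ENNReal.toReal_nonneg
  set F : ℝ → ℂ := fun t => logCoord c f t with hF
  have hFi : Integrable F := by
    have := hf.memLp_logCoord_ofReal le_rfl ha
    rw [ENNReal.ofReal_one] at this
    exact memLp_one_iff_integrable.1 this
  have hFc : Continuous F := hf.continuous_logCoord_ofReal ha
  set m : ℝ → ℂ := 𝓕 F with hm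
  have hmc : Continuous m := continuous_fourier_of_integrable hFi
  have hdecay : ∀ w, ‖m w‖ ≤ 2 * N * Real.exp (-(2 * Real.pi * a * |w|)) := by
    refine norm_fourier_le_of_strip ha hN0 hf.differentiableAt_logCoord hFi ?_
    intro b hb
    have h := hf.mellinXNorm_add_le le_rfl hb
    rw [ENNReal.rpow_one, ENNReal.rpow_one, ENNReal.rpow_one,
      ← eLpNorm_logCoord_horizontal le_rfl, ← eLpNorm_logCoord_horizontal le_rfl,
      ENNReal.ofReal_one, eLpNorm_one_eq_lintegral_enorm, eLpNorm_one_eq_lintegral_enorm] at h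
    exact h
  have hexpi : Integrable fun w : ℝ => Real.exp (-(2 * Real.pi * a * |w|)) := by
    refine ⟨Continuous.aestronglyMeasurable (by fun_prop), ?_⟩
    rw [hasFiniteIntegral_iff_ofReal (Eventually.of_forall fun _ => (Real.exp_pos _).le),
      lintegral_exp_neg_mul_abs (by positivity)]
    exact ENNReal.ofReal_lt_top
  have hmi : Integrable m :=
    (hexpi.const_mul (2 * N)).mono' hmc.aestronglyMeasurable (Eventually.of_forall hdecay)
  have hinv : 𝓕⁻ m = F := hFc.fourierInv_fourier_eq hFi hmi
  set ψ : ℝ → ℂ := fun v => m (-(2 * Real.pi)⁻¹ * v) with hψ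
  have hψc : Continuous ψ := hmc.comp (by fun_prop)
  have hψle : ∀ v, ‖ψ v‖ ≤ 2 * N * Real.exp (-(a * |v|)) := by
    intro v
    refine (hdecay _).trans (le_of_eq ?_)
    rw [abs_neg_two_pi_inv_mul]
    congr 3
    field_simp
  have hne0 : ∀ᵐ v : ℝ, v ≠ 0 := by simp [ae_iff]
  -- The tail estimate at τ = 0 covers all of ψ, since its indicator omits only the null set {0}.
  have hψq : MemLp ψ q := by
    refine ⟨hψc.aestronglyMeasurable, (hK ψ 0 le_rfl ?_).trans_lt ENNReal.ofReal_lt_top⟩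
    filter_upwards [hne0] with v hv
    rw [indicator_of_mem (show v ∈ {v : ℝ | 0 < |v|} from abs_pos.2 hv)]
    exact hψle v
  have hrep : IsMellinRep q c (fun x => f (x, 0)) ψ :=
    isMellinRep_of_fourierInv hmi (fun t => by rw [hinv, hF]; exact logCoord_ofReal c f t) hψq
  refine ⟨⟨ψ, hrep⟩, ?_⟩
  have hτ : ∀ τ ∈ Ioo 0 σ, mellinDist q 1 c σ f ≤ ENNReal.ofReal (K * Real.exp (-(a * τ))) := by
    intro τ hτ
    -- In the variable v the bump is 1 for |v| ≤ τ and 0 for |v| ≥ σ. The competitor lies in the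
    -- Bernstein space of type σ, while the error lives on |v| > τ; letting τ increase to σ recovers
    -- the constant.
    let β : ContDiffBump (0 : ℝ) := ⟨τ / (2 * Real.pi), σ / (2 * Real.pi),
      div_pos hτ.1 (by positivity), by have := hτ.2; gcongr⟩
    have hs : HasCompactSupport (fun x => (β x : ℂ)) :=
      β.hasCompactSupport.comp_left (g := Complex.ofReal) rfl
    have hd : ContDiff ℝ ∞ (fun x => (β x : ℂ)) := Complex.ofRealCLM.contDiff.comp β.contDiff
    refine (mellinDist_le_eLpNorm (β := fun w => (β w : ℂ)) le_rfl hσ.le hrep hmi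
      (Complex.measurable_ofReal.comp β.continuous.measurable) (fun w => ?_) (fun w hw => ?_)
      ?_).trans (hK _ τ hτ.1.le (Eventually.of_forall fun v => ?_))
    · rw [Complex.norm_real, Real.norm_of_nonneg β.nonneg]
      exact β.le_one
    · rw [β.zero_of_le_dist (by rw [dist_zero_right]; exact hw.le), Complex.ofReal_zero]
    · rw [ENNReal.ofReal_one, memLp_one_iff_integrable]
      exact integrable_fourierInv_fourier_mul hFi (hs.toSchwartzMap hd)
    · by_cases hv : τ < |v|
      · rw [indicator_of_mem (show v ∈ {v : ℝ | τ < |v|} from hv)]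
        refine le_trans ?_ (hψle v)
        have h1 : ‖(1 : ℂ) - (β (-(2 * Real.pi)⁻¹ * v) : ℂ)‖ ≤ 1 := by
          rw [← Complex.ofReal_one, ← Complex.ofReal_sub, Complex.norm_real, Real.norm_of_nonneg
            (sub_nonneg.2 β.le_one)]
          linarith [β.nonneg (x := -(2 * Real.pi)⁻¹ * v)]
        rw [← mul_one_sub, norm_mul]
        exact mul_le_of_le_one_right (norm_nonneg _) h1
      · rw [indicator_of_notMem (show v ∉ {v : ℝ | τ < |v|} from hv), β.one_of_mem_closedBall]
        · simp
        · rw [mem_closedBall_zero_iff, Real.norm_eq_abs, abs_neg_two_pi_inv_mul]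
          change _ ≤ τ / (2 * Real.pi)
          rw [div_eq_inv_mul]
          have := not_lt.1 hv
          gcongr
  have hlim : Tendsto (fun τ : ℝ => ENNReal.ofReal (K * Real.exp (-(a * τ)))) (𝓝[<] σ)
      (𝓝 (ENNReal.ofReal (K * Real.exp (-(a * σ))))) := by
    refine Tendsto.mono_left ?_ nhdsWithin_le_nhds
    exact (ENNReal.continuous_ofReal.comp (by fun_prop :
      Continuous fun τ : ℝ => K * Real.exp (-(a * τ)))).tendsto σ
  refine ge_of_tendsto hlim ?_
  filter_upwards [Ioo_mem_nhdsLT hσ] with τ h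
  exact hτ τ h

/-- The distance estimate for `p = 2`, for any norm that is controlled on tails of functions whose
product with `e^{a|v|}` is square integrable. -/
theorem mellinDist_two_le {a c σ K : ℝ} (ha : 0 < a) (hσ : 0 < σ) {f : ℝ × ℝ → ℂ}
    (hf : MemMellinHardy 2 c a f) {q : ℝ≥0∞}
    (hK : ∀ (h W : ℝ → ℂ) (τ : ℝ), 0 ≤ τ → AEStronglyMeasurable W volume →
      eLpNorm W 2 volume ≤ ENNReal.ofReal (2 * √Real.pi * mellinHardyNorm 2 c a f) →
      (∀ᵐ v, h v =
        W v * {v : ℝ | τ < |v|}.indicator (fun v => (Real.exp (-(a * |v|)) : ℂ)) v) →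
      eLpNorm h q volume ≤ ENNReal.ofReal (K * Real.exp (-(a * τ)))) :
    MemMellinG q c (fun x => f (x, 0)) ∧
      mellinDist q 2 c σ f ≤ ENNReal.ofReal (K * Real.exp (-(a * σ))) := by
  have hpi := Real.pi_pos
  set N := mellinHardyNorm 2 c a f with hN
  have hN0 : 0 ≤ N := ENNReal.toReal_nonneg
  have h12 : (1 : ℝ) ≤ 2 := one_le_two
  have hF2 : MemLp (fun t : ℝ => logCoord c f t) 2 := by
    simpa using hf.memLp_logCoord_ofReal h12 ha
  obtain ⟨m, hmi, hinv, hmw⟩ := exists_fourierInv_eq_of_strip (K := 2 * ENNReal.ofReal N ^ 2) ha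
    (ENNReal.mul_ne_top (by norm_num) (ENNReal.pow_ne_top ENNReal.ofReal_ne_top))
    hf.differentiableAt_logCoord hF2 (by
      intro b hb
      have h := hf.mellinXNorm_add_le h12 hb
      rw [ENNReal.rpow_two, ENNReal.rpow_two, ENNReal.rpow_two,
        ← eLpNorm_logCoord_horizontal h12, ← eLpNorm_logCoord_horizontal h12,
        ENNReal.ofReal_ofNat, ← lintegral_enorm_sq_eq, ← lintegral_enorm_sq_eq] at h
      exact h)
  have hm2 : MemLp m 2 := by
    refine ⟨hmi.1, ?_⟩
    have : eLpNorm m 2 volume ^ 2 < ⊤ := by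
      rw [← lintegral_enorm_sq_eq]
      refine lt_of_le_of_lt (lintegral_mono fun w => ?_) (hmw.trans_lt
        (ENNReal.mul_lt_top (by norm_num) (ENNReal.pow_lt_top ENNReal.ofReal_lt_top)))
      refine le_mul_of_one_le_right' ?_
      rw [← ENNReal.ofReal_one]
      exact ENNReal.ofReal_le_ofReal (Real.one_le_exp (by positivity))
    simpa using this
  set ψ : ℝ → ℂ := fun v => m (-(2 * Real.pi)⁻¹ * v) with hψ
  have hψi : Integrable ψ := hmi.comp_mul_left' (by simp [hpi.ne'])
  set W : ℝ → ℂ := fun v => ψ v * (Real.exp (a * |v|) : ℂ) with hW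
  have hWm : AEStronglyMeasurable W volume :=
    hψi.1.mul (Continuous.aestronglyMeasurable (by fun_prop))
  have hWle : eLpNorm W 2 volume ≤ ENNReal.ofReal (2 * √Real.pi * N) := by
    -- The substitution v = -2πw contributes 2π, and 2π · 2N² = (2√π N)².
    have hsq : eLpNorm W 2 volume ^ 2 ≤ ENNReal.ofReal (2 * √Real.pi * N) ^ 2 := by
      have himg : (fun w : ℝ => -(2 * Real.pi) * w) '' univ = univ := by
        rw [image_univ]
        exact (mul_left_surjective₀ (by simp [hpi.ne'])).range_eq
      have hder : ∀ w : ℝ, HasDerivAt (fun w : ℝ => -(2 * Real.pi) * w) (-(2 * Real.pi)) w :=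
        fun w => by simpa using (hasDerivAt_id w).const_mul (-(2 * Real.pi))
      rw [← lintegral_enorm_sq_eq, ← setLIntegral_univ, ← himg,
        lintegral_image_eq_lintegral_abs_deriv_mul MeasurableSet.univ
          (fun w _ => (hder w).hasDerivWithinAt)
          (mul_right_injective₀ (by simp [hpi.ne'])).injOn, setLIntegral_univ,
        lintegral_const_mul' _ _ ENNReal.ofReal_ne_top, abs_neg, abs_of_pos (by positivity)]
      have hptw : ∀ w : ℝ, ‖W (-(2 * Real.pi) * w)‖ₑ ^ 2 =
          ‖m w‖ₑ ^ 2 * ENNReal.ofReal (Real.exp (4 * Real.pi * a * |w|)) := by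
        intro w
        simp only [hW, hψ]
        rw [enorm_mul, mul_pow, ← ofReal_norm (Complex.ofReal _), Complex.norm_real,
          Real.norm_of_nonneg (Real.exp_pos _).le, ofReal_exp_sq, abs_mul, abs_neg,
          abs_of_pos (by positivity)]
        have e1 : -(2 * Real.pi)⁻¹ * (-(2 * Real.pi) * w) = w := by field_simp
        have e2 : 2 * (a * (2 * Real.pi * |w|)) = 4 * Real.pi * a * |w| := by ring
        rw [e1, e2]
      simp_rw [hptw]
      refine (mul_le_mul' le_rfl hmw).trans (le_of_eq ?_)
      rw [← ENNReal.ofReal_pow hN0, ← ENNReal.ofReal_pow (by positivity),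
        ← ENNReal.ofReal_ofNat 2, ← ENNReal.ofReal_mul zero_le_two,
        ← ENNReal.ofReal_mul (by positivity)]
      congr 1
      rw [mul_pow, mul_pow, Real.sq_sqrt hpi.le]
      ring
    exact (ENNReal.pow_le_pow_left_iff two_ne_zero).1 hsq
  have hψW : ∀ v, ψ v = W v * (Real.exp (-(a * |v|)) : ℂ) := by
    intro v
    rw [hW]
    simp only
    rw [mul_assoc, ← Complex.ofReal_mul, ← Real.exp_add]
    simp
  have hne0 : ∀ᵐ v : ℝ, v ≠ 0 := by simp [ae_iff]
  have hψq : MemLp ψ q := by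
    refine ⟨hψi.1, (hK ψ W 0 le_rfl hWm hWle ?_).trans_lt ENNReal.ofReal_lt_top⟩
    filter_upwards [hne0] with v hv
    rw [indicator_of_mem (show v ∈ {v : ℝ | 0 < |v|} from abs_pos.2 hv)]
    exact hψW v
  have hrep : IsMellinRep q c (fun x => f (x, 0)) ψ :=
    isMellinRep_of_fourierInv hmi (fun t => by rw [hinv]; exact logCoord_ofReal c f t) hψq
  refine ⟨⟨ψ, hrep⟩, ?_⟩
  -- The sharp cut-off is admissible here: by Plancherel the truncated transform still has a square
  -- integrable inverse.
  set S : Set ℝ := {w | |w| ≤ σ / (2 * Real.pi)} with hS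
  have hSm : MeasurableSet S := measurableSet_le (by fun_prop) measurable_const
  set β : ℝ → ℂ := S.indicator 1 with hβ
  have hβm : Measurable β := measurable_one.indicator hSm
  have hβ1 : ∀ w, ‖β w‖ ≤ 1 := fun w => by
    by_cases hw : w ∈ S
    · simp [hβ, indicator_of_mem hw]
    · simp [hβ, indicator_of_notMem hw]
  refine (mellinDist_le_eLpNorm h12 hσ.le hrep hmi hβm hβ1 (fun w hw => ?_) ?_).trans
    (hK _ W σ hσ.le hWm hWle (Eventually.of_forall fun v => ?_))
  · exact indicator_of_notMem (show w ∉ S from not_le.2 hw) _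
  · rw [ENNReal.ofReal_ofNat]
    refine memLp_fourierInv
      (hmi.mul_bdd (c := 1) hβm.aestronglyMeasurable (Eventually.of_forall hβ1))
      (hm2.mono (hmi.1.mul hβm.aestronglyMeasurable) (Eventually.of_forall fun w => ?_))
    rw [norm_mul]
    exact mul_le_of_le_one_right (norm_nonneg _) (hβ1 w)
  · have hiff : -(2 * Real.pi)⁻¹ * v ∈ S ↔ |v| ≤ σ := by
      rw [hS, mem_ofPred_eq, abs_neg_two_pi_inv_mul, div_eq_inv_mul]
      exact mul_le_mul_iff_right₀ (by positivity)
    by_cases hv : σ < |v|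
    · rw [indicator_of_mem (show v ∈ {v : ℝ | σ < |v|} from hv), hβ,
        indicator_of_notMem (fun h => not_lt.2 (hiff.1 h) hv), mul_zero, sub_zero]
      exact hψW v
    · rw [indicator_of_notMem (show v ∉ {v : ℝ | σ < |v|} from hv), hβ,
        indicator_of_mem (hiff.2 (not_lt.1 hv))]
      simp

theorem theorem6 (a c σ : ℝ) (ha : 0 < a) (hσ : 0 < σ) (f : ℝ × ℝ → ℂ) :
    (MemMellinHardy 1 c a f →
      (∀ q : ℝ, 1 ≤ q →
        MemMellinG (ENNReal.ofReal q) c (fun x => f (x, 0)) ∧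
        mellinDist (ENNReal.ofReal q) 1 c σ f ≤
          ENNReal.ofReal
            (2 * mellinHardyNorm 1 c a f * (2 / (a * q)) ^ (1 / q) * Real.exp (-(a * σ)))) ∧
      (MemMellinG ⊤ c (fun x => f (x, 0)) ∧
        mellinDist ⊤ 1 c σ f ≤
          ENNReal.ofReal (2 * mellinHardyNorm 1 c a f * Real.exp (-(a * σ))))) ∧
    (MemMellinHardy 2 c a f →
      (MemMellinG 2 c (fun x => f (x, 0)) ∧
        mellinDist 2 2 c σ f ≤
          ENNReal.ofReal
            (2 * √Real.pi * mellinHardyNorm 2 c a f * Real.exp (-(a * σ)))) ∧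
      (∀ q : ℝ, 1 ≤ q → q < 2 →
        MemMellinG (ENNReal.ofReal q) c (fun x => f (x, 0)) ∧
        mellinDist (ENNReal.ofReal q) 2 c σ f ≤
          ENNReal.ofReal
            (2 * √Real.pi * ((2 - q) / (q * a)) ^ (1 / q - 1 / 2) *
              mellinHardyNorm 2 c a f * Real.exp (-(a * σ))))) := by
  refine ⟨fun hf => ⟨fun q hq => ?_, ?_⟩, fun hf => ⟨?_, fun q hq1 hq2 => ?_⟩⟩
  · have hA : 0 ≤ 2 * mellinHardyNorm 1 c a f := mul_nonneg zero_le_two ENNReal.toReal_nonneg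
    exact mellinDist_one_le ha hσ hf fun h τ hτ hh =>
      eLpNorm_le_of_exp_tail hA ha hτ (by linarith) hh
  · have hA : 0 ≤ 2 * mellinHardyNorm 1 c a f := mul_nonneg zero_le_two ENNReal.toReal_nonneg
    exact mellinDist_one_le ha hσ hf fun h τ hτ hh => eLpNorm_top_le_of_exp_tail hA ha hh
  · refine mellinDist_two_le ha hσ hf fun h W τ hτ hWm hW hh => ?_
    -- For q = 2 no Hölder step is needed: e^{-a|v|} ≤ e^{-aτ} on the tail.
    have hle : ∀ᵐ v, ‖h v‖ ≤ Real.exp (-(a * τ)) * ‖W v‖ := by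
      filter_upwards [hh] with v hv
      rw [hv, norm_mul, mul_comm]
      refine mul_le_mul_of_nonneg_right ?_ (norm_nonneg _)
      by_cases hmem : v ∈ {v : ℝ | τ < |v|}
      · rw [indicator_of_mem hmem, Complex.norm_real, Real.norm_of_nonneg (Real.exp_pos _).le]
        have : τ < |v| := hmem
        gcongr
      · rw [indicator_of_notMem hmem, norm_zero]
        positivity
    refine (eLpNorm_le_mul_eLpNorm_of_ae_le_mul hle 2).trans ((mul_le_mul' le_rfl hW).trans
      (le_of_eq ?_))
    rw [← ENNReal.ofReal_mul (Real.exp_pos _).le, mul_comm]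
  · have hA : 0 ≤ 2 * √Real.pi * mellinHardyNorm 2 c a f :=
      mul_nonneg (by positivity) ENNReal.toReal_nonneg
    have hcomm : 2 * √Real.pi * ((2 - q) / (q * a)) ^ (1 / q - 1 / 2) *
        mellinHardyNorm 2 c a f = 2 * √Real.pi * mellinHardyNorm 2 c a f *
          ((2 - q) / (q * a)) ^ (1 / q - 1 / 2) := by ring
    rw [hcomm]
    exact mellinDist_two_le ha hσ hf fun h W τ hτ hWm hW hh =>
      eLpNorm_le_of_weighted_sq_tail hA ha hτ hq1 hq2 hWm hW hh
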